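/- Let $A$ be a smooth, finitely generated, commutative algebra over $\mathbf{C}$ and let $d\ge 0$. Let $P(A)$ be the Poisson envelope of $A$, i.e. the value at $A$ of the left adjoint of the functor from Poisson algebras over $\mathbf{C}$ to commutative algebras over $\mathbf{C}$ which forgets the Poisson bracket, and let $P^d(A)\subset P(A)$ be the $A$-submodule spanned by all formal expressions in elements of $A$, built by products and Poisson brackets, which contain exactly $d$ brackets. For an $A$-module $M$ let $\mathrm{Lie}_A(M)=\bigoplus_{n\ge 1}\mathrm{Lie}_A^n(M)$ be the free Lie algebra over $A$ generated by the module $M$, put $\mathrm{Lie}_{A,\ge 2}(M)=\bigoplus_{n\ge 2}\mathrm{Lie}_A^n(M)$ with $\mathrm{Lie}_A^n(M)$ placed in degree $n-1$, and let $Q_A^d(M)=S_A(\mathrm{Lie}_{A,\ge 2}(M))^d$ be the degree $d$ part of its symmetric algebra over $A$ for the induced grading. Then $P^d(A)$ is isomorphic to $Q_A^d(\Omega^1_A)$ as an $A$-module, where $\Omega^1_A$ is the module of Kähler differentials of $A$ over $\mathbf{C}$. -/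

import Mathlib

noncomputable section

/-! ### Poisson algebras and the Poisson envelope -/

/-- A Poisson bracket on a commutative `R`-algebra `P`: an `R`-bilinear alternating operation
which satisfies the Jacobi identity and is a derivation in each argument (the derivation property
in the first argument follows by antisymmetry). -/
structure PoissonBracket (R P : Type*) [CommRing R] [CommRing P] [Algebra R P] where
  /-- The bracket. -/
  bracket : P →ₗ[R] P →ₗ[R] P
  bracket_self : ∀ x, bracket x x = 0
  jacobi : ∀ x y z, bracket x (bracket y z) = bracket (bracket x y) z + bracket y (bracket x z)
  leibniz : ∀ x y z, bracket x (y * z) = bracket x y * z + y * bracket x z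

/-- Formal expressions in elements of `A`, with formal sums, products and Poisson brackets. -/
inductive PoissonExpr (A : Type*) : Type _
  | of (a : A) : PoissonExpr A
  | add (x y : PoissonExpr A) : PoissonExpr A
  | mul (x y : PoissonExpr A) : PoissonExpr A
  | bracket (x y : PoissonExpr A) : PoissonExpr A

/-- The relations between formal expressions which hold in every Poisson `R`-algebra that receives
a homomorphism of commutative `R`-algebras from `A`. -/
inductive PoissonExpr.Rel (R : Type*) {A : Type*} [CommRing R] [CommRing A] [Algebra R A] :
    PoissonExpr A → PoissonExpr A → Prop
  -- compatibility with the operations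
  | congr_add_left {x x'} (y) : Rel R x x' → Rel R (add x y) (add x' y)
  | congr_add_right (x) {y y'} : Rel R y y' → Rel R (add x y) (add x y')
  | congr_mul_left {x x'} (y) : Rel R x x' → Rel R (mul x y) (mul x' y)
  | congr_mul_right (x) {y y'} : Rel R y y' → Rel R (mul x y) (mul x y')
  | congr_bracket_left {x x'} (y) : Rel R x x' → Rel R (bracket x y) (bracket x' y)
  | congr_bracket_right (x) {y y'} : Rel R y y' → Rel R (bracket x y) (bracket x y')
  -- commutative ring axioms
  | add_comm (x y) : Rel R (add x y) (add y x)
  | add_assoc (x y z) : Rel R (add (add x y) z) (add x (add y z))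
  | zero_add (x) : Rel R (add (of 0) x) x
  | mul_comm (x y) : Rel R (mul x y) (mul y x)
  | mul_assoc (x y z) : Rel R (mul (mul x y) z) (mul x (mul y z))
  | one_mul (x) : Rel R (mul (of 1) x) x
  | zero_mul (x) : Rel R (mul (of 0) x) (of 0)
  | mul_add (x y z) : Rel R (mul x (add y z)) (add (mul x y) (mul x z))
  -- `of` is additive and multiplicative
  | of_add (a b : A) : Rel R (of (a + b)) (add (of a) (of b))
  | of_mul (a b : A) : Rel R (of (a * b)) (mul (of a) (of b))
  -- Poisson bracket axioms
  | add_bracket (x y z) : Rel R (bracket (add x y) z) (add (bracket x z) (bracket y z))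
  | bracket_add (x y z) : Rel R (bracket x (add y z)) (add (bracket x y) (bracket x z))
  | smul_bracket (r : R) (x y) :
      Rel R (bracket (mul (of (algebraMap R A r)) x) y)
        (mul (of (algebraMap R A r)) (bracket x y))
  | bracket_smul (r : R) (x y) :
      Rel R (bracket x (mul (of (algebraMap R A r)) y))
        (mul (of (algebraMap R A r)) (bracket x y))
  | bracket_self (x) : Rel R (bracket x x) (of 0)
  | jacobi (x y z) :
      Rel R (bracket x (bracket y z)) (add (bracket (bracket x y) z) (bracket y (bracket x z)))
  | leibniz (x y z) :
      Rel R (bracket x (mul y z)) (add (mul (bracket x y) z) (mul y (bracket x z)))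

/-- The Poisson envelope `P(A)` of a commutative `R`-algebra `A`: the Poisson `R`-algebra generated
by the elements of `A` subject to the relations of the commutative `R`-algebra `A`. -/
def PoissonEnvelope (R A : Type*) [CommRing R] [CommRing A] [Algebra R A] : Type _ :=
  Quot (PoissonExpr.Rel R (A := A))

namespace PoissonEnvelope

open PoissonExpr

variable (R : Type*) {A : Type*} [CommRing R] [CommRing A] [Algebra R A]

/-- The element of `P(A)` given by a formal expression. -/
def mk (x : PoissonExpr A) : PoissonEnvelope R A := Quot.mk _ x

variable {R} in
theorem sound {x y : PoissonExpr A} (h : PoissonExpr.Rel R x y) : mk R x = mk R y := Quot.sound h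

instance : Zero (PoissonEnvelope R A) := ⟨mk R (of 0)⟩
instance : One (PoissonEnvelope R A) := ⟨mk R (of 1)⟩
instance : Add (PoissonEnvelope R A) :=
  ⟨Quot.map₂ add (fun x _ _ h => .congr_add_right x h) (fun _ _ y h => .congr_add_left y h)⟩
instance : Mul (PoissonEnvelope R A) :=
  ⟨Quot.map₂ mul (fun x _ _ h => .congr_mul_right x h) (fun _ _ y h => .congr_mul_left y h)⟩
instance : Neg (PoissonEnvelope R A) := ⟨fun x => mk R (of (-1)) * x⟩

instance : CommRing (PoissonEnvelope R A) where
  add_assoc := by rintro ⟨x⟩ ⟨y⟩ ⟨z⟩; exact Quot.sound (.add_assoc x y z)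
  zero_add := by rintro ⟨x⟩; exact Quot.sound (.zero_add x)
  add_zero := by
    rintro ⟨x⟩; exact (Quot.sound (.add_comm x (of 0))).trans (Quot.sound (.zero_add x))
  add_comm := by rintro ⟨x⟩ ⟨y⟩; exact Quot.sound (.add_comm x y)
  nsmul := nsmulRec
  zsmul := zsmulRec
  mul_assoc := by rintro ⟨x⟩ ⟨y⟩ ⟨z⟩; exact Quot.sound (.mul_assoc x y z)
  mul_comm := by rintro ⟨x⟩ ⟨y⟩; exact Quot.sound (.mul_comm x y)
  one_mul := by rintro ⟨x⟩; exact Quot.sound (.one_mul x)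
  mul_one := by
    rintro ⟨x⟩; exact (Quot.sound (.mul_comm x (of 1))).trans (Quot.sound (.one_mul x))
  zero_mul := by rintro ⟨x⟩; exact Quot.sound (.zero_mul x)
  mul_zero := by
    rintro ⟨x⟩; exact (Quot.sound (.mul_comm x (of 0))).trans (Quot.sound (.zero_mul x))
  left_distrib := by rintro ⟨x⟩ ⟨y⟩ ⟨z⟩; exact Quot.sound (.mul_add x y z)
  right_distrib := by
    rintro ⟨x⟩ ⟨y⟩ ⟨z⟩
    refine (Quot.sound (.mul_comm (add x y) z)).trans ((Quot.sound (.mul_add z x y)).trans ?_)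
    exact (Quot.sound (.congr_add_left _ (.mul_comm z x))).trans
      (Quot.sound (.congr_add_right _ (.mul_comm z y)))
  neg_add_cancel := by
    rintro ⟨x⟩
    have h : PoissonExpr.Rel R (of (-1 + 1)) (add (of (-1)) (of (1 : A))) := .of_add (-1) 1
    rw [neg_add_cancel] at h
    change mk R (add (mul (of (-1)) x) x) = mk R (of 0)
    rw [sound (.congr_add_left x (.mul_comm (of (-1)) x)),
      ← sound (.congr_add_right (mul x (of (-1))) (.one_mul x)),
      sound (.congr_add_right (mul x (of (-1))) (.mul_comm (of 1) x)),
      ← sound (.mul_add x (of (-1)) (of 1)), ← sound (.congr_mul_right x h),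
      sound (.mul_comm x (of 0)), sound (.zero_mul x)]

variable (A) in
/-- The structure homomorphism `A → P(A)`. -/
def ofHom : A →+* PoissonEnvelope R A where
  toFun a := mk R (of a)
  map_zero' := rfl
  map_one' := rfl
  map_add' a b := Quot.sound (.of_add a b)
  map_mul' a b := Quot.sound (.of_mul a b)

/-- `P(A)` is an `A`-algebra. -/
instance : Algebra A (PoissonEnvelope R A) := (ofHom R A).toAlgebra

/-- `P(A)` is an `R`-algebra. -/
instance : Algebra R (PoissonEnvelope R A) := ((ofHom R A).comp (algebraMap R A)).toAlgebra

instance : IsScalarTower R A (PoissonEnvelope R A) := .of_algebraMap_eq fun _ => rfl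

variable (A) in
/-- The Poisson bracket of `P(A)`. -/
def poissonBracket : PoissonBracket R (PoissonEnvelope R A) where
  bracket := LinearMap.mk₂ R
    (Quot.map₂ bracket (fun x _ _ h => .congr_bracket_right x h)
      (fun _ _ y h => .congr_bracket_left y h))
    (by rintro ⟨x⟩ ⟨y⟩ ⟨z⟩; exact Quot.sound (.add_bracket x y z))
    (by rintro r ⟨x⟩ ⟨y⟩; exact Quot.sound (.smul_bracket r x y))
    (by rintro ⟨x⟩ ⟨y⟩ ⟨z⟩; exact Quot.sound (.bracket_add x y z))
    (by rintro r ⟨x⟩ ⟨y⟩; exact Quot.sound (.bracket_smul r x y))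
  bracket_self := by rintro ⟨x⟩; exact Quot.sound (.bracket_self x)
  jacobi := by rintro ⟨x⟩ ⟨y⟩ ⟨z⟩; exact Quot.sound (.jacobi x y z)
  leibniz := by rintro ⟨x⟩ ⟨y⟩ ⟨z⟩; exact Quot.sound (.leibniz x y z)

/-- The universal property of the Poisson envelope (it is left adjoint to the functor which forgets
the bracket): a homomorphism of commutative algebras from `A` to a Poisson algebra extends uniquely
to a homomorphism of Poisson algebras from `P(A)`. -/
theorem existsUnique_lift {P : Type*} [CommRing P] [Algebra R P] (b : PoissonBracket R P)
    (f : A →ₐ[R] P) :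
    ∃! g : PoissonEnvelope R A →ₐ[R] P,
      (∀ a, g (algebraMap A (PoissonEnvelope R A) a) = f a) ∧
        ∀ x y, g ((poissonBracket R A).bracket x y) = b.bracket (g x) (g y) := by
  let ev : PoissonExpr A → P := fun x =>
    PoissonExpr.rec (fun a => f a) (fun _ _ u v => u + v) (fun _ _ u v => u * v)
      (fun _ _ u v => b.bracket u v) x
  have ev_of (a) : ev (of a) = f a := rfl
  have ev_add (x y) : ev (add x y) = ev x + ev y := rfl
  have ev_mul (x y) : ev (mul x y) = ev x * ev y := rfl
  have ev_bracket (x y) : ev (bracket x y) = b.bracket (ev x) (ev y) := rfl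
  have ev_rel (x y) (h : PoissonExpr.Rel R x y) : ev x = ev y := by
    induction h with
    | congr_add_left | congr_add_right | congr_mul_left | congr_mul_right | congr_bracket_left
    | congr_bracket_right => simp only [*]
    | bracket_self => simp [ev_of, ev_bracket, b.bracket_self]
    | jacobi => simpa only [ev_add, ev_bracket] using b.jacobi _ _ _
    | leibniz => simpa only [ev_add, ev_mul, ev_bracket] using b.leibniz _ _ _
    | smul_bracket r | bracket_smul r =>
      simp only [ev_mul, ev_of, ev_bracket, AlgHom.commutes, ← Algebra.smul_def, map_smul,
        LinearMap.smul_apply]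
    | _ =>
      simp only [ev_add, ev_mul, ev_of, ev_bracket, map_add, map_mul, map_zero, map_one,
        LinearMap.add_apply]
      try ring
  refine ⟨{ toFun := Quot.lift ev ev_rel
            map_one' := map_one f
            map_mul' := by rintro ⟨x⟩ ⟨y⟩; rfl
            map_zero' := map_zero f
            map_add' := by rintro ⟨x⟩ ⟨y⟩; rfl
            commutes' := f.commutes },
    ⟨fun _ => rfl, by rintro ⟨x⟩ ⟨y⟩; rfl⟩, ?_⟩
  rintro g ⟨hg, hg'⟩
  refine AlgHom.ext ?_
  rintro ⟨x⟩
  change g (mk R x) = ev x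
  induction x with
  | of a => exact hg a
  | add x y hx hy => rw [ev_add, ← hx, ← hy]; exact map_add g (mk R x) (mk R y)
  | mul x y hx hy => rw [ev_mul, ← hx, ← hy]; exact map_mul g (mk R x) (mk R y)
  | bracket x y hx hy => rw [ev_bracket, ← hx, ← hy]; exact hg' (mk R x) (mk R y)

/-- `IsMonomial R d x`: the element `x` of `P(A)` is given by a formal expression, built from
elements of `A` by products and brackets, which contains exactly `d` instances of brackets. -/
inductive IsMonomial : ℕ → PoissonEnvelope R A → Prop
  | of (a : A) : IsMonomial 0 (algebraMap A (PoissonEnvelope R A) a)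
  | mul {m n : ℕ} {x y : PoissonEnvelope R A} :
      IsMonomial m x → IsMonomial n y → IsMonomial (m + n) (x * y)
  | bracket {m n : ℕ} {x y : PoissonEnvelope R A} :
      IsMonomial m x → IsMonomial n y →
        IsMonomial (m + n + 1) ((poissonBracket R A).bracket x y)

variable (A) in
/-- The degree `d` part `P^d(A)` of the Poisson envelope, with its `A`-module structure. -/
def degreePart (d : ℕ) : Submodule A (PoissonEnvelope R A) :=
  Submodule.span A {x | IsMonomial R d x}

end PoissonEnvelope

/-! ### The free Lie algebra of a module and the functors `Q^d` -/

/-- The free Lie `A`-algebra `Lie(M)` of an `A`-module `M`: the quotient of the free Lie algebra on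
the underlying set of `M` by the Lie ideal which makes the generators depend `A`-linearly on the
elements of `M`. -/
abbrev ModuleLie (A M : Type*) [CommRing A] [AddCommGroup M] [Module A M] : Type _ :=
  FreeLieAlgebra A M ⧸ LieSubmodule.lieSpan A (FreeLieAlgebra A M)
    ({z | ∃ x y : M, z = .of A (x + y) - (.of A x + .of A y)} ∪
      {z | ∃ (a : A) (x : M), z = .of A (a • x) - a • .of A x})

namespace ModuleLie

variable (A : Type*) {M : Type*} [CommRing A] [AddCommGroup M] [Module A M]

/-- The canonical `A`-linear map `M → Lie(M)`. -/
def ι : M →ₗ[A] ModuleLie A M where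
  toFun x := LieSubmodule.Quotient.mk (FreeLieAlgebra.of A x)
  map_add' x y := (Submodule.Quotient.eq _).2
    (LieSubmodule.subset_lieSpan (Or.inl ⟨x, y, rfl⟩))
  map_smul' a x := (Submodule.Quotient.eq _).2
    (LieSubmodule.subset_lieSpan (Or.inr ⟨a, x, rfl⟩))

/-- The universal property of `Lie(M)`: a linear map from `M` to a Lie algebra extends uniquely to
a homomorphism of Lie algebras from `Lie(M)`. -/
theorem existsUnique_lift {L : Type*} [LieRing L] [LieAlgebra A L] (f : M →ₗ[A] L) :
    ∃! g : ModuleLie A M →ₗ⁅A⁆ L, ∀ x, g (ι A x) = f x := by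
  let F : FreeLieAlgebra A M →ₗ⁅A⁆ L := FreeLieAlgebra.lift A f
  have hF (x : M) : F (.of A x) = f x := FreeLieAlgebra.lift_of_apply _ x
  have hker : LieSubmodule.lieSpan A (FreeLieAlgebra A M)
      ({z | ∃ x y : M, z = .of A (x + y) - (.of A x + .of A y)} ∪
        {z | ∃ (a : A) (x : M), z = .of A (a • x) - a • .of A x}) ≤ F.ker := by
    rw [LieSubmodule.lieSpan_le]
    rintro z (⟨x, y, rfl⟩ | ⟨a, x, rfl⟩) <;> simp [hF]
  refine ⟨{ Submodule.liftQ _ (F : FreeLieAlgebra A M →ₗ[A] L) (fun z hz => ?_) with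
            map_lie' := ?_ }, fun x => hF x, ?_⟩
  · exact F.mem_ker.1 (hker hz)
  · rintro ⟨x⟩ ⟨y⟩
    exact F.map_lie x y
  · intro g hg
    let π : FreeLieAlgebra A M →ₗ⁅A⁆ ModuleLie A M :=
      { Submodule.mkQ _ with map_lie' := rfl }
    have h : g.comp π = F := FreeLieAlgebra.hom_ext fun x => (hg x).trans (hF x).symm
    refine LieHom.ext ?_
    rintro ⟨x⟩
    exact LieHom.congr_fun h x

/-- `IsMonomial A n z`: the element `z` of `Lie(M)` is an iterated bracket, with any bracketing,
of `n` elements of `M`. -/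
inductive IsMonomial : ℕ → ModuleLie A M → Prop
  | ι (x : M) : IsMonomial 1 (ι A x)
  | lie {m n : ℕ} {x y : ModuleLie A M} :
      IsMonomial m x → IsMonomial n y → IsMonomial (m + n) ⁅x, y⁆

variable (M) in
/-- The degree `n` part `Lie^n(M)` of the free Lie algebra. -/
def degreePart (n : ℕ) : Submodule A (ModuleLie A M) :=
  Submodule.span A {z | IsMonomial A n z}

end ModuleLie

/-- `Lie_{≥ 2}(M)`, the direct sum of the `Lie^n(M)` over `n ≥ 2`; the summand with index `i` is
`Lie^{i + 2}(M)`, and it has degree `i + 1`. -/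
abbrev LiePlus (A M : Type*) [CommRing A] [AddCommGroup M] [Module A M] : Type _ :=
  DirectSum ℕ fun i => ModuleLie.degreePart A M (i + 2)

/-- `Q^d(M)`, the degree `d` part of the symmetric algebra of `Lie_{≥ 2}(M)`: it is spanned by the
products of elements `y j ∈ Lie^{n j + 2}(M)`, which have degree `n j + 1`, with total degree `d`. -/
def QPart (A M : Type*) [CommRing A] [AddCommGroup M] [Module A M] (d : ℕ) :
    Submodule A (SymmetricAlgebra A (LiePlus A M)) :=
  Submodule.span A {z | ∃ (k : ℕ) (n : Fin k → ℕ)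
    (y : ∀ j, ModuleLie.degreePart A M (n j + 2)),
    ∑ j, (n j + 1) = d ∧
      z = ∏ j, SymmetricAlgebra.ι A (LiePlus A M)
        (DirectSum.lof A ℕ (fun i => ModuleLie.degreePart A M (i + 2)) (n j) (y j))}

end

/-! Write `Ω` for the module of Kähler differentials of `A` over the base ring `R`. It is
projective, so the surjection `a ⊗ b ↦ a db` from `A ⊗ A` to `Ω` has a section, which extends to a
homomorphism of Lie algebras from `Lie(Ω)` to `A ⊗ P(A)`. Composing it with the multiplication map
to `P(A)` destroys compatibility with the brackets, but by the Leibniz rule only up to products of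
elements of positive degree. By induction on the degree, the resulting map from the symmetric
algebra of `Lie_{≥ 2}(Ω)` to `P(A)` is therefore surjective in each degree.

For injectivity, let `I` be the augmentation ideal of the symmetric algebra of `Lie(Ω)`, with its
Kirillov–Kostant bracket. As `A` is formally smooth, the homomorphism `a ↦ a + da` from `A` to the
symmetric algebra modulo `I ^ 2` lifts to the quotient by each higher power of `I`, and the lift
extends to a Poisson homomorphism on `P(A)`. Composing it with the map from the symmetric algebra
of `Lie_{≥ 2}(Ω)` gives the inclusion up to terms of higher order, and the powers of the
augmentation ideal intersect in zero. -/

noncomputable section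

open scoped TensorProduct

/-! ### Poisson algebras -/

namespace PoissonBracket

section

variable {R P : Type*} [CommRing R] [CommRing P] [Algebra R P] (b : PoissonBracket R P)

theorem neg_bracket (x y : P) : -b.bracket x y = b.bracket y x := by
  have h := b.bracket_self (x + y)
  simp only [map_add, LinearMap.add_apply, b.bracket_self, zero_add, add_zero] at h
  exact neg_eq_of_add_eq_zero_left h

theorem mul_bracket (x y z : P) : b.bracket (x * y) z = x * b.bracket y z + b.bracket x z * y := by
  rw [← b.neg_bracket, b.leibniz, ← b.neg_bracket x z, ← b.neg_bracket y z]
  ring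

/-- The Hamiltonian derivation `{x, -}` of a Poisson algebra. -/
def hamiltonian (x : P) : Derivation R P P :=
  Derivation.mk' (b.bracket x) fun y z => by
    rw [b.leibniz, smul_eq_mul, smul_eq_mul, mul_comm z, add_comm]

theorem bracket_algebraMap (x : P) (r : R) : b.bracket x (algebraMap R P r) = 0 :=
  (b.hamiltonian x).map_algebraMap r

/-- The Poisson bracket on the quotient of a Poisson algebra by a Poisson ideal. -/
def quotient (I : Ideal P) (h : ∀ x, ∀ y ∈ I, b.bracket x y ∈ I) : PoissonBracket R (P ⧸ I) where
  bracket := LinearMap.mk₂ R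
    (Quotient.map₂ (fun x y => b.bracket x y) fun x x' hx y y' hy => by
      have hleft : b.bracket (x - x') y ∈ I :=
        b.neg_bracket y _ ▸ I.neg_mem (h y _ ((Submodule.quotientRel_def I).1 hx))
      have hright : b.bracket x' (y - y') ∈ I := h x' _ ((Submodule.quotientRel_def I).1 hy)
      refine (Submodule.quotientRel_def I).2 ?_
      simpa only [map_sub, LinearMap.sub_apply, sub_add_sub_cancel] using I.add_mem hleft hright)
    (by rintro ⟨x⟩ ⟨x'⟩ ⟨y⟩; exact congrArg (Ideal.Quotient.mk I) (b.bracket.map_add₂ x x' y))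
    (by rintro r ⟨x⟩ ⟨y⟩; exact congrArg (Ideal.Quotient.mk I) (b.bracket.map_smul₂ r x y))
    (by rintro ⟨x⟩ ⟨y⟩ ⟨y'⟩; exact congrArg (Ideal.Quotient.mk I) (map_add (b.bracket x) y y'))
    (by rintro r ⟨x⟩ ⟨y⟩; exact congrArg (Ideal.Quotient.mk I) (map_smul (b.bracket x) r y))
  bracket_self := by rintro ⟨x⟩; exact congrArg (Ideal.Quotient.mk I) (b.bracket_self x)
  jacobi := by rintro ⟨x⟩ ⟨y⟩ ⟨z⟩; exact congrArg (Ideal.Quotient.mk I) (b.jacobi x y z)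
  leibniz := by rintro ⟨x⟩ ⟨y⟩ ⟨z⟩; exact congrArg (Ideal.Quotient.mk I) (b.leibniz x y z)

theorem bracket_mem_pow {I : Ideal P} {x : P} (h : ∀ y ∈ I, b.bracket x y ∈ I) (k : ℕ) :
    ∀ y ∈ I ^ k, b.bracket x y ∈ I ^ k := by
  induction k with
  | zero => simp
  | succ k ih =>
    intro y hy
    rw [pow_succ] at hy ⊢
    induction hy using Submodule.mul_induction_on' with
    | mem_mul_mem y hy z hz =>
      rw [b.leibniz]
      exact add_mem (Ideal.mul_mem_mul (ih y hy) hz) (Ideal.mul_mem_mul hy (h z hz))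
    | add y _ z _ hy hz => rw [map_add]; exact add_mem hy hz

end

section

variable (R : Type*) {A P : Type*} [CommRing R] [CommRing A] [Algebra R A] [CommRing P]
  [Algebra A P] [Algebra R P] [IsScalarTower R A P]

/-- A Poisson `A`-algebra as a Poisson algebra over a ring `R` which maps to `A`. -/
def restrictScalars (b : PoissonBracket A P) : PoissonBracket R P where
  bracket := b.bracket.restrictScalars₁₂ R R
  bracket_self := b.bracket_self
  jacobi := b.jacobi
  leibniz := b.leibniz

theorem restrictScalars_bracket (b : PoissonBracket A P) (x y : P) :
    (b.restrictScalars R).bracket x y = b.bracket x y :=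
  rfl

end

/-- The Poisson bracket on the square-zero extension of `R` by a Lie algebra. -/
def trivSqZeroExt (R L : Type*) [CommRing R] [LieRing L] [LieAlgebra R L] [Module Rᵐᵒᵖ L]
    [IsCentralScalar R L] : PoissonBracket R (TrivSqZeroExt R L) where
  bracket := LinearMap.mk₂ R (fun x y => .inr ⁅x.snd, y.snd⁆)
    (by simp) (by simp) (by simp) (by simp)
  bracket_self := by simp
  jacobi x y z := by simp
  leibniz x y z := by ext <;> simp [add_comm]

theorem trivSqZeroExt_bracket {R L : Type*} [CommRing R] [LieRing L] [LieAlgebra R L]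
    [Module Rᵐᵒᵖ L] [IsCentralScalar R L] (x y : TrivSqZeroExt R L) :
    (trivSqZeroExt R L).bracket x y = .inr ⁅x.snd, y.snd⁆ :=
  rfl

end PoissonBracket

/-! ### The Poisson algebra `Sym(L)` -/

section

open SymmetricAlgebra (ι)

variable {R M : Type*} [CommRing R] [AddCommGroup M] [Module R M]

theorem symmetricAlgebra_derivation_ext
    {D E : Derivation R (SymmetricAlgebra R M) (SymmetricAlgebra R M)}
    (h : ∀ m, D (ι R M m) = E (ι R M m)) : D = E := by
  ext w
  induction w using SymmetricAlgebra.induction with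
  | algebraMap r => rw [D.map_algebraMap, E.map_algebraMap]
  | ι m => exact h m
  | mul a b ha hb => rw [D.leibniz, E.leibniz, ha, hb]
  | add a b ha hb => rw [map_add, map_add, ha, hb]

/-- The homomorphism `w ↦ w + ε D w` to the dual numbers of the symmetric algebra, where `D` is the
derivation which extends `f`. -/
def symmetricDualNumberLift (f : M →ₗ[R] SymmetricAlgebra R M) :
    SymmetricAlgebra R M →ₐ[R] TrivSqZeroExt (SymmetricAlgebra R M) (SymmetricAlgebra R M) :=
  SymmetricAlgebra.lift ((TrivSqZeroExt.inlAlgHom R _ _).toLinearMap ∘ₗ ι R M +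
    (TrivSqZeroExt.inrHom (SymmetricAlgebra R M) (SymmetricAlgebra R M)).restrictScalars R ∘ₗ f)

theorem fst_symmetricDualNumberLift (f : M →ₗ[R] SymmetricAlgebra R M)
    (w : SymmetricAlgebra R M) : (symmetricDualNumberLift f w).fst = w := by
  have h : (TrivSqZeroExt.fstHom R _ _).comp (symmetricDualNumberLift f) = AlgHom.id R _ := by
    ext m
    simp [symmetricDualNumberLift]
  exact AlgHom.congr_fun h w

/-- The derivation of the symmetric algebra which extends a linear map on the generators. -/
def symmetricDerivation :
    (M →ₗ[R] SymmetricAlgebra R M) →ₗ[R]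
      Derivation R (SymmetricAlgebra R M) (SymmetricAlgebra R M) where
  toFun f := Derivation.mk'
    ((TrivSqZeroExt.sndHom (SymmetricAlgebra R M) (SymmetricAlgebra R M)).restrictScalars R ∘ₗ
      (symmetricDualNumberLift f).toLinearMap)
    fun a b => by simp [fst_symmetricDualNumberLift, mul_comm]
  map_add' f g := symmetricAlgebra_derivation_ext fun m => by simp [symmetricDualNumberLift]
  map_smul' r f := symmetricAlgebra_derivation_ext fun m => by simp [symmetricDualNumberLift]

@[simp]
theorem symmetricDerivation_ι (f : M →ₗ[R] SymmetricAlgebra R M) (m : M) :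
    symmetricDerivation f (ι R M m) = f m := by
  simp [symmetricDerivation, symmetricDualNumberLift]

/-- The biderivation of the symmetric algebra which extends a bilinear map on the generators. -/
def symmetricBiderivation (β : M →ₗ[R] M →ₗ[R] SymmetricAlgebra R M) :
    SymmetricAlgebra R M →ₗ[R] SymmetricAlgebra R M →ₗ[R] SymmetricAlgebra R M :=
  let extend : (M →ₗ[R] SymmetricAlgebra R M) →ₗ[R] SymmetricAlgebra R M →ₗ[R] _ :=
    { toFun f := (symmetricDerivation f : SymmetricAlgebra R M →ₗ[R] _)
      map_add' f g := by rw [map_add, Derivation.coe_add_linearMap]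
      map_smul' r f := by rw [map_smul, Derivation.coe_smul_linearMap, RingHom.id_apply] }
  (extend ∘ₗ (extend ∘ₗ β).flip).flip

section Biderivation

variable (β : M →ₗ[R] M →ₗ[R] SymmetricAlgebra R M)

theorem symmetricBiderivation_mul_left (u v w : SymmetricAlgebra R M) :
    symmetricBiderivation β (u * v) w =
      u * symmetricBiderivation β v w + v * symmetricBiderivation β u w := by
  simp [symmetricBiderivation]

theorem symmetricBiderivation_algebraMap_left (r : R) (w : SymmetricAlgebra R M) :
    symmetricBiderivation β (algebraMap R _ r) w = 0 := by
  simp [symmetricBiderivation]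

theorem symmetricBiderivation_ι_left (m : M) (w : SymmetricAlgebra R M) :
    symmetricBiderivation β (ι R M m) w = symmetricDerivation (β m) w := by
  simp [symmetricBiderivation]

theorem symmetricBiderivation_mul_right (u v w : SymmetricAlgebra R M) :
    symmetricBiderivation β u (v * w) =
      symmetricBiderivation β u v * w + v * symmetricBiderivation β u w := by
  induction u using SymmetricAlgebra.induction with
  | algebraMap r => simp [symmetricBiderivation_algebraMap_left]
  | ι m => simp only [symmetricBiderivation_ι_left, Derivation.leibniz, smul_eq_mul]; ring
  | mul a b ha hb => simp only [symmetricBiderivation_mul_left, ha, hb]; ring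
  | add a b ha hb => simp only [map_add, LinearMap.add_apply, ha, hb]; ring

theorem symmetricBiderivation_algebraMap_right (r : R) (w : SymmetricAlgebra R M) :
    symmetricBiderivation β w (algebraMap R _ r) = 0 := by
  induction w using SymmetricAlgebra.induction with
  | algebraMap s => exact symmetricBiderivation_algebraMap_left β s _
  | ι m => rw [symmetricBiderivation_ι_left, Derivation.map_algebraMap]
  | mul a b ha hb => rw [symmetricBiderivation_mul_left, ha, hb, mul_zero, mul_zero, add_zero]
  | add a b ha hb => rw [map_add, LinearMap.add_apply, ha, hb, add_zero]

variable {β}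

theorem neg_symmetricBiderivation (hβ : ∀ x y, -β x y = β y x) (u v : SymmetricAlgebra R M) :
    -symmetricBiderivation β u v = symmetricBiderivation β v u := by
  induction u using SymmetricAlgebra.induction with
  | algebraMap r =>
    rw [symmetricBiderivation_algebraMap_left, symmetricBiderivation_algebraMap_right, neg_zero]
  | ι x =>
    induction v using SymmetricAlgebra.induction with
    | algebraMap r =>
      rw [symmetricBiderivation_algebraMap_left, symmetricBiderivation_algebraMap_right, neg_zero]
    | ι y => simp [symmetricBiderivation_ι_left, hβ]
    | mul a b ha hb =>
      rw [symmetricBiderivation_mul_left, symmetricBiderivation_mul_right, ← ha, ← hb]; ring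
    | add a b ha hb => rw [map_add, map_add, LinearMap.add_apply, ← ha, ← hb, neg_add]
  | mul a b ha hb =>
    rw [symmetricBiderivation_mul_left, symmetricBiderivation_mul_right, ← ha, ← hb]; ring
  | add a b ha hb => rw [map_add, map_add, LinearMap.add_apply, ← ha, ← hb, neg_add]

theorem symmetricBiderivation_self (hβ : ∀ x, β x x = 0) (u : SymmetricAlgebra R M) :
    symmetricBiderivation β u u = 0 := by
  have hneg := neg_symmetricBiderivation (LinearMap.IsAlt.neg hβ)
  induction u using SymmetricAlgebra.induction with
  | algebraMap r => exact symmetricBiderivation_algebraMap_left β r _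
  | ι x => rw [symmetricBiderivation_ι_left, symmetricDerivation_ι, hβ]
  | mul a b ha hb =>
    rw [symmetricBiderivation_mul_left, symmetricBiderivation_mul_right,
      symmetricBiderivation_mul_right, ha, hb, ← hneg a b]
    ring
  | add a b ha hb => rw [map_add, map_add, LinearMap.add_apply, LinearMap.add_apply, ha, hb,
      ← hneg a b, zero_add, add_zero, neg_add_cancel]

end Biderivation

end

section

open SymmetricAlgebra (ι)

variable {R L : Type*} [CommRing R] [LieRing L] [LieAlgebra R L]

variable (R L) in
/-- The biderivation of the symmetric algebra of a Lie algebra which extends the Lie bracket. -/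
def symmetricLieBracket :
    SymmetricAlgebra R L →ₗ[R] SymmetricAlgebra R L →ₗ[R] SymmetricAlgebra R L :=
  symmetricBiderivation ((LieModule.toEnd R L L : L →ₗ[R] Module.End R L).compr₂ (ι R L))

local notation "⦃" u ", " v "⦄" => symmetricLieBracket R L u v

theorem symmetricLieBracket_ι_ι (x y : L) : ⦃ι R L x, ι R L y⦄ = ι R L ⁅x, y⁆ := by
  simp [symmetricLieBracket, symmetricBiderivation_ι_left]

theorem symmetricLieBracket_algebraMap_left (r : R) (w : SymmetricAlgebra R L) :
    ⦃algebraMap R _ r, w⦄ = 0 :=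
  symmetricBiderivation_algebraMap_left _ r w

theorem symmetricLieBracket_mul_left (u v w : SymmetricAlgebra R L) :
    ⦃u * v, w⦄ = u * ⦃v, w⦄ + v * ⦃u, w⦄ :=
  symmetricBiderivation_mul_left _ u v w

theorem symmetricLieBracket_mul_right (u v w : SymmetricAlgebra R L) :
    ⦃u, v * w⦄ = ⦃u, v⦄ * w + v * ⦃u, w⦄ :=
  symmetricBiderivation_mul_right _ u v w

theorem symmetricLieBracket_jacobi_ι_ι (x y : L) (w : SymmetricAlgebra R L) :
    ⦃ι R L x, ⦃ι R L y, w⦄⦄ = ⦃⦃ι R L x, ι R L y⦄, w⦄ + ⦃ι R L y, ⦃ι R L x, w⦄⦄ := by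
  have hD (z w) : ⦃ι R L z, w⦄ = symmetricDerivation (ι R L ∘ₗ LieModule.toEnd R L L z) w :=
    symmetricBiderivation_ι_left _ z w
  have hlie : ⁅symmetricDerivation (ι R L ∘ₗ LieModule.toEnd R L L x),
      symmetricDerivation (ι R L ∘ₗ LieModule.toEnd R L L y)⁆ =
        symmetricDerivation (ι R L ∘ₗ LieModule.toEnd R L L ⁅x, y⁆) :=
    symmetricAlgebra_derivation_ext fun z => by
      simp [Derivation.commutator_apply, -LieHom.map_lie]
  rw [symmetricLieBracket_ι_ι, hD, hD, hD, hD, hD, ← hlie, Derivation.commutator_apply,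
    sub_add_cancel]

theorem symmetricLieBracket_jacobi (u v w : SymmetricAlgebra R L) :
    ⦃u, ⦃v, w⦄⦄ = ⦃⦃u, v⦄, w⦄ + ⦃v, ⦃u, w⦄⦄ := by
  have hneg : ∀ a b, -⦃a, b⦄ = ⦃b, a⦄ := neg_symmetricBiderivation fun x y => by simp [← map_neg]
  induction u using SymmetricAlgebra.induction with
  | algebraMap r => simp [symmetricLieBracket_algebraMap_left]
  | ι x =>
    induction v using SymmetricAlgebra.induction with
    | algebraMap r =>
      simp [← hneg (algebraMap R _ r) (ι R L x), symmetricLieBracket_algebraMap_left]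
    | ι y => exact symmetricLieBracket_jacobi_ι_ι x y w
    | mul a b ha hb =>
      simp only [symmetricLieBracket_mul_left, symmetricLieBracket_mul_right, map_add,
        LinearMap.add_apply, ha, hb]
      ring
    | add a b ha hb => simp only [map_add, LinearMap.add_apply, ha, hb]; ring
  | mul a b ha hb =>
    simp only [symmetricLieBracket_mul_left, symmetricLieBracket_mul_right, map_add,
      LinearMap.add_apply, ha, hb, ← hneg a v, ← hneg b v]
    ring
  | add a b ha hb => simp only [map_add, LinearMap.add_apply, ha, hb]; ring

namespace PoissonBracket

variable (R L) in
/-- The Kirillov–Kostant bracket on the symmetric algebra of a Lie algebra. -/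
def kirillovKostant : PoissonBracket R (SymmetricAlgebra R L) where
  bracket := symmetricLieBracket R L
  bracket_self := symmetricBiderivation_self fun x => by simp
  jacobi := symmetricLieBracket_jacobi
  leibniz := symmetricLieBracket_mul_right

theorem kirillovKostant_ι_ι (x y : L) :
    (kirillovKostant R L).bracket (ι R L x) (ι R L y) = ι R L ⁅x, y⁆ :=
  symmetricLieBracket_ι_ι x y

end PoissonBracket

end

/-! ### The augmentation ideal of a symmetric algebra -/

theorem map_mem_pow_of_map_le {S B : Type*} [CommRing S] [CommRing B] {f : S →+* B} {I : Ideal S}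
    {N : Ideal B} (h : I.map f ≤ N) {j : ℕ} {q : S} (hq : q ∈ I ^ j) : f q ∈ N ^ j :=
  Ideal.pow_right_mono h j (Ideal.map_pow f I j ▸ Ideal.mem_map_of_mem f hq)

section

open SymmetricAlgebra (ι)

variable {R M : Type*} [CommRing R] [AddCommGroup M] [Module R M]

variable (R M) in
/-- The augmentation ideal of the symmetric algebra, generated by the module. -/
def augmentationIdeal : Ideal (SymmetricAlgebra R M) := Ideal.span (Set.range (ι R M))

theorem ι_mem_augmentationIdeal (m : M) : ι R M m ∈ augmentationIdeal R M :=
  Ideal.subset_span ⟨m, rfl⟩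

theorem map_augmentationIdeal_le {B : Type*} [CommRing B] {f : SymmetricAlgebra R M →+* B}
    {N : Ideal B} (h : ∀ m, f (ι R M m) ∈ N) : (augmentationIdeal R M).map f ≤ N := by
  rw [augmentationIdeal, Ideal.map_span, Ideal.span_le]
  rintro _ ⟨_, ⟨m, rfl⟩, rfl⟩
  exact h m

/-- The substitution `m ↦ t m`, for which the `j`-th power of the augmentation ideal lands in the
ideal generated by `t ^ j`. -/
def symmetricRescale : SymmetricAlgebra R M →ₐ[R] Polynomial (SymmetricAlgebra R M) :=
  SymmetricAlgebra.lift
    (LinearMap.mulLeft R Polynomial.X ∘ₗ Polynomial.CAlgHom.toLinearMap ∘ₗ ι R M)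

theorem eval_one_symmetricRescale (q : SymmetricAlgebra R M) :
    (symmetricRescale q).eval 1 = q := by
  have h : ((Polynomial.aeval (1 : SymmetricAlgebra R M)).restrictScalars R).comp
      symmetricRescale = AlgHom.id R _ := by
    ext m
    simp [symmetricRescale]
  exact AlgHom.congr_fun h q

theorem iInf_augmentationIdeal_pow : ⨅ j, augmentationIdeal R M ^ j = ⊥ := by
  refine eq_bot_iff.2 fun q hq => ?_
  have hX (m : M) : symmetricRescale (ι R M m) ∈
      Ideal.span {(Polynomial.X : Polynomial (SymmetricAlgebra R M))} := by
    simp [symmetricRescale, Ideal.mem_span_singleton]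
  have hzero : symmetricRescale q = 0 := by
    ext n
    have hdvd := map_mem_pow_of_map_le
      (map_augmentationIdeal_le (f := (symmetricRescale : _ →ₐ[R] _).toRingHom) hX)
      (Ideal.mem_iInf.1 hq (n + 1))
    rw [Ideal.span_singleton_pow, Ideal.mem_span_singleton, Polynomial.X_pow_dvd_iff] at hdvd
    exact hdvd n n.lt_succ_self
  rw [Submodule.mem_bot, ← eval_one_symmetricRescale q, hzero, Polynomial.eval_zero]

end

section Comparison

open SymmetricAlgebra (ι)

theorem sub_mem_pow_succ_of_mem_pow {S B : Type*} [CommRing S] [CommRing B] {f g : S →+* B}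
    {I : Ideal S} {N : Ideal B} (h0 : ∀ x, f x - g x ∈ N) (h1 : ∀ x ∈ I, f x - g x ∈ N ^ 2)
    (hg : I.map g ≤ N) {j : ℕ} {q : S} (hq : q ∈ I ^ j) : f q - g q ∈ N ^ (j + 1) := by
  induction j generalizing q with
  | zero => simpa using h0 q
  | succ j ih =>
    rw [pow_succ] at hq
    induction hq using Submodule.mul_induction_on' with
    | mem_mul_mem x hx y hy =>
      have hgx : g x ∈ N ^ j := map_mem_pow_of_map_le hg hx
      have hfy : f y ∈ N := by
        simpa using N.add_mem (h0 y) (hg (Ideal.mem_map_of_mem g hy))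
      rw [map_mul, map_mul,
        show f x * f y - g x * g y = (f x - g x) * f y + g x * (f y - g y) by ring]
      refine add_mem ?_ ?_
      · rw [pow_succ N (j + 1)]; exact Ideal.mul_mem_mul (ih hx) hfy
      · rw [add_assoc, pow_add]; exact Ideal.mul_mem_mul hgx (h1 y hy)
    | add x _ y _ hx hy =>
      rw [map_add, map_add, add_sub_add_comm]
      exact add_mem hx hy

variable {R M B : Type*} [CommRing R] [AddCommGroup M] [Module R M] [CommRing B]
  {f g : SymmetricAlgebra R M →+* B} {N : Ideal B}

theorem sub_mem_of_algebraMap_of_ι (h0 : ∀ r, f (algebraMap R _ r) - g (algebraMap R _ r) ∈ N)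
    (h1 : ∀ m, f (ι R M m) - g (ι R M m) ∈ N) (q : SymmetricAlgebra R M) : f q - g q ∈ N := by
  simp only [← Ideal.Quotient.eq] at h0 h1 ⊢
  induction q using SymmetricAlgebra.induction with
  | algebraMap r => exact h0 r
  | ι m => exact h1 m
  | mul a b ha hb => simp only [map_mul, ha, hb]
  | add a b ha hb => simp only [map_add, ha, hb]

theorem sub_mem_sq_of_mem_augmentationIdeal
    (h0 : ∀ r, f (algebraMap R _ r) - g (algebraMap R _ r) ∈ N)
    (h1 : ∀ m, f (ι R M m) - g (ι R M m) ∈ N ^ 2) (hg : ∀ m, g (ι R M m) ∈ N)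
    {q : SymmetricAlgebra R M} (hq : q ∈ augmentationIdeal R M) : f q - g q ∈ N ^ 2 := by
  induction hq using Submodule.span_induction with
  | mem x hx => obtain ⟨m, rfl⟩ := hx; exact h1 m
  | zero => simp
  | add x y _ _ hx hy => rw [map_add, map_add, add_sub_add_comm]; exact add_mem hx hy
  | smul a x hx' hx =>
    have ha : f a - g a ∈ N :=
      sub_mem_of_algebraMap_of_ι h0 (fun m => Ideal.pow_le_self two_ne_zero (h1 m)) a
    have hgx : g x ∈ N := map_augmentationIdeal_le hg (Ideal.mem_map_of_mem g hx')
    rw [smul_eq_mul, map_mul, map_mul,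
      show f a * f x - g a * g x = f a * (f x - g x) + (f a - g a) * g x by ring, sq]
    exact add_mem (Ideal.mul_mem_left _ _ (sq N ▸ hx)) (Ideal.mul_mem_mul ha hgx)

theorem sub_mem_pow_succ_of_mem_augmentationIdeal_pow
    (h0 : ∀ r, f (algebraMap R _ r) - g (algebraMap R _ r) ∈ N)
    (h1 : ∀ m, f (ι R M m) - g (ι R M m) ∈ N ^ 2) (hg : ∀ m, g (ι R M m) ∈ N) {j : ℕ}
    {q : SymmetricAlgebra R M} (hq : q ∈ augmentationIdeal R M ^ j) :
    f q - g q ∈ N ^ (j + 1) :=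
  sub_mem_pow_succ_of_mem_pow
    (sub_mem_of_algebraMap_of_ι h0 fun m => Ideal.pow_le_self two_ne_zero (h1 m))
    (fun _ hx => sub_mem_sq_of_mem_augmentationIdeal h0 h1 hg hx)
    (map_augmentationIdeal_le hg) hq

end Comparison

section Linearization

open SymmetricAlgebra (ι)

variable {R M : Type*} [CommRing R] [AddCommGroup M] [Module R M] [Module Rᵐᵒᵖ M]
  [IsCentralScalar R M]

/-- The projection of the symmetric algebra onto its terms of degree at most one. -/
def symmetricLinearization : SymmetricAlgebra R M →ₐ[R] TrivSqZeroExt R M :=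
  SymmetricAlgebra.lift (TrivSqZeroExt.inrHom R M)

@[simp]
theorem symmetricLinearization_ι (m : M) : symmetricLinearization (ι R M m) = .inr m :=
  SymmetricAlgebra.lift_ι_apply _ m

theorem symmetricLinearization_surjective :
    Function.Surjective (symmetricLinearization (R := R) (M := M)) := fun x =>
  ⟨algebraMap R _ x.fst + ι R M x.snd, by
    rw [map_add, AlgHom.commutes, symmetricLinearization_ι, TrivSqZeroExt.algebraMap_eq_inl,
      TrivSqZeroExt.inl_fst_add_inr_snd_eq]⟩

theorem symmetricLinearization_eq_zero {u : SymmetricAlgebra R M}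
    (hu : u ∈ augmentationIdeal R M ^ 2) : symmetricLinearization u = 0 := by
  have hle : (augmentationIdeal R M).map (symmetricLinearization (R := R) (M := M)).toRingHom ≤
      TrivSqZeroExt.kerIdeal R M :=
    map_augmentationIdeal_le fun m => by simp [TrivSqZeroExt.mem_kerIdeal_iff_inr]
  simpa [TrivSqZeroExt.kerIdeal_sq] using map_mem_pow_of_map_le hle hu

theorem mem_sq_of_symmetricLinearization_eq_zero {u : SymmetricAlgebra R M}
    (hu : symmetricLinearization u = 0) : u ∈ augmentationIdeal R M ^ 2 := by
  let sec : TrivSqZeroExt R M →ₐ[R] SymmetricAlgebra R M ⧸ augmentationIdeal R M ^ 2 :=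
    TrivSqZeroExt.liftEquivOfComm ⟨(Ideal.Quotient.mkₐ R _).toLinearMap ∘ₗ ι R M, fun x y =>
      Ideal.Quotient.eq_zero_iff_mem.2 (sq (augmentationIdeal R M) ▸
        Ideal.mul_mem_mul (ι_mem_augmentationIdeal x) (ι_mem_augmentationIdeal y))⟩
  have hsec : sec.comp symmetricLinearization = Ideal.Quotient.mkₐ R _ := by
    ext m
    simp [sec]
  refine Ideal.Quotient.eq_zero_iff_mem.1 ((AlgHom.congr_fun hsec u).symm.trans ?_)
  rw [AlgHom.comp_apply, hu, map_zero]

theorem mem_augmentationIdeal_of_fst_symmetricLinearization_eq_zero {u : SymmetricAlgebra R M}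
    (hu : (symmetricLinearization u).fst = 0) : u ∈ augmentationIdeal R M := by
  have hsq : u - ι R M (symmetricLinearization u).snd ∈ augmentationIdeal R M ^ 2 := by
    apply mem_sq_of_symmetricLinearization_eq_zero
    ext <;> simp [hu]
  rw [← sub_add_cancel u (ι R M (symmetricLinearization u).snd)]
  exact add_mem (Ideal.pow_le_self two_ne_zero hsq) (ι_mem_augmentationIdeal _)

end Linearization

/-! ### Truncations of the Poisson algebra `Sym(L)` -/

section

variable (A L : Type*) [CommRing A] [AddCommGroup L] [Module A L] [Module Aᵐᵒᵖ L]
  [IsCentralScalar A L]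

/-- The projection of a truncated symmetric algebra onto its terms of degree at most one. -/
def truncationLinearization (k : ℕ) :
    SymmetricAlgebra A L ⧸ augmentationIdeal A L ^ (k + 2) →ₐ[A] TrivSqZeroExt A L :=
  Ideal.Quotient.liftₐ _ symmetricLinearization fun _ hu =>
    symmetricLinearization_eq_zero (Ideal.pow_le_pow_right (Nat.le_add_left 2 k) hu)

theorem truncationLinearization_surjective (k : ℕ) :
    Function.Surjective (truncationLinearization A L k) :=
  Ideal.Quotient.lift_surjective_of_surjective _ _ symmetricLinearization_surjective

variable {A L} {k : ℕ} {u : SymmetricAlgebra A L ⧸ augmentationIdeal A L ^ (k + 2)}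

theorem mem_map_mk_of_fst_truncationLinearization_eq_zero
    (hu : (truncationLinearization A L k u).fst = 0) :
    u ∈ (augmentationIdeal A L).map (Ideal.Quotient.mk (augmentationIdeal A L ^ (k + 2))) := by
  obtain ⟨u, rfl⟩ := Ideal.Quotient.mk_surjective u
  exact Ideal.mem_map_of_mem _ (mem_augmentationIdeal_of_fst_symmetricLinearization_eq_zero hu)

theorem mem_map_mk_sq_of_truncationLinearization_eq_zero
    (hu : truncationLinearization A L k u = 0) :
    u ∈ (augmentationIdeal A L).map (Ideal.Quotient.mk (augmentationIdeal A L ^ (k + 2))) ^ 2 := by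
  obtain ⟨u, rfl⟩ := Ideal.Quotient.mk_surjective u
  rw [← Ideal.map_pow]
  exact Ideal.mem_map_of_mem _ (mem_sq_of_symmetricLinearization_eq_zero hu)

variable (A L k) in
theorem isNilpotent_ker_truncationLinearization :
    IsNilpotent (RingHom.ker (truncationLinearization A L k)) := by
  refine ⟨k + 2, le_bot_iff.1 ?_⟩
  have hle : RingHom.ker (truncationLinearization A L k) ≤
      (augmentationIdeal A L).map (Ideal.Quotient.mk (augmentationIdeal A L ^ (k + 2))) :=
    fun _ hu => Ideal.pow_le_self two_ne_zero (mem_map_mk_sq_of_truncationLinearization_eq_zero hu)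
  refine (Ideal.pow_right_mono hle (k + 2)).trans ?_
  rw [← Ideal.map_pow, Ideal.map_quotient_self]

end

/-! ### Injectivity of homomorphisms out of a symmetric algebra -/

section

open SymmetricAlgebra (ι)

variable {A M N B : Type*} [CommRing A] [AddCommGroup M] [Module A M] [Module Aᵐᵒᵖ M]
  [IsCentralScalar A M] [AddCommGroup N] [Module A N] [CommRing B] [Algebra A B]
  {i : N →ₗ[A] M} {ψ : SymmetricAlgebra A N →ₐ[A] B} {T : B →+* TrivSqZeroExt A M}

theorem lift_mem_augmentationIdeal_pow_succ (hT : ∀ a, (T (algebraMap A B a)).fst = a)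
    (hψ : ∀ y, T (ψ (ι A N y)) = .inr (i y)) {j : ℕ}
    {Φ : B →+* SymmetricAlgebra A M ⧸ augmentationIdeal A M ^ (j + 2)}
    (hΦ : ∀ x, truncationLinearization A M j (Φ x) = T x) {q : SymmetricAlgebra A N}
    (hq : q ∈ augmentationIdeal A N ^ j) (hψq : ψ q = 0) :
    SymmetricAlgebra.lift (ι A M ∘ₗ i) q ∈ augmentationIdeal A M ^ (j + 1) := by
  let mk := Ideal.Quotient.mk (augmentationIdeal A M ^ (j + 2))
  let g := mk.comp (SymmetricAlgebra.lift (ι A M ∘ₗ i)).toRingHom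
  have hmk (w) : truncationLinearization A M j (mk w) = symmetricLinearization w := rfl
  have hgι (y) : g (ι A N y) = mk (ι A M (i y)) := by simp [g]
  have hsub : Φ.comp ψ.toRingHom q - g q ∈ (augmentationIdeal A M).map mk ^ (j + 1) := by
    refine sub_mem_pow_succ_of_mem_augmentationIdeal_pow (fun a => ?_) (fun y => ?_)
      (fun y => ?_) hq
    · apply mem_map_mk_of_fst_truncationLinearization_eq_zero
      have hga : g (algebraMap A _ a) = mk (algebraMap A _ a) := by simp [g]
      simp [hga, hmk, hΦ, hT, TrivSqZeroExt.algebraMap_eq_inl]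
    · apply mem_map_mk_sq_of_truncationLinearization_eq_zero
      simp [hgι, hmk, hΦ, hψ]
    · exact hgι y ▸ Ideal.mem_map_of_mem mk (ι_mem_augmentationIdeal _)
  have hzero : Φ.comp ψ.toRingHom q = 0 := by simp [hψq]
  rw [hzero, zero_sub, neg_mem_iff, ← Ideal.map_pow] at hsub
  exact (Ideal.mem_quotient_iff_mem (Ideal.pow_le_pow_right (Nat.le_succ _))).1 hsub

/-- `T` is a left inverse of `ψ` to first order. Its lifts `Φ` are left inverses of `ψ` up to terms
of higher order, and the powers of the augmentation ideal intersect in zero. -/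
theorem injective_of_exists_truncationLinearization_comp_eq {r : M →ₗ[A] N}
    (hr : r ∘ₗ i = LinearMap.id) (hT : ∀ a, (T (algebraMap A B a)).fst = a)
    (hψ : ∀ y, T (ψ (ι A N y)) = .inr (i y))
    (hΦ : ∀ k, ∃ Φ : B →+* SymmetricAlgebra A M ⧸ augmentationIdeal A M ^ (k + 2),
      ∀ x, truncationLinearization A M k (Φ x) = T x) :
    Function.Injective ψ := by
  have hretract : (SymmetricAlgebra.lift (ι A N ∘ₗ r)).comp (SymmetricAlgebra.lift (ι A M ∘ₗ i)) =
      AlgHom.id A (SymmetricAlgebra A N) := by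
    ext y
    simpa using congrArg (ι A N) (LinearMap.congr_fun hr y)
  refine (injective_iff_map_eq_zero ψ).2 fun q hψq => ?_
  suffices hmem : ∀ j, q ∈ augmentationIdeal A N ^ j by
    simpa [iInf_augmentationIdeal_pow] using Ideal.mem_iInf.2 hmem
  intro j
  induction j with
  | zero => simp
  | succ j hq =>
    obtain ⟨Φ, hΦ⟩ := hΦ j
    have hr_le : (augmentationIdeal A M).map (SymmetricAlgebra.lift (ι A N ∘ₗ r)).toRingHom ≤
        augmentationIdeal A N :=
      map_augmentationIdeal_le fun m => by simp [ι_mem_augmentationIdeal]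
    rw [← AlgHom.id_apply (R := A) q, ← hretract]
    exact map_mem_pow_of_map_le hr_le (lift_mem_augmentationIdeal_pow_succ hT hψ hΦ hq hψq)

end

namespace PoissonBracket

open SymmetricAlgebra (ι)

theorem map_bracket_symmetricAlgebra {R M P : Type*} [CommRing R] [AddCommGroup M] [Module R M]
    [CommRing P] [Algebra R P] (b : PoissonBracket R (SymmetricAlgebra R M))
    (b' : PoissonBracket R P) (f : SymmetricAlgebra R M →ₐ[R] P)
    (hf : ∀ x y, f (b.bracket (ι R M x) (ι R M y)) = b'.bracket (f (ι R M x)) (f (ι R M y)))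
    (u v : SymmetricAlgebra R M) : f (b.bracket u v) = b'.bracket (f u) (f v) := by
  induction u using SymmetricAlgebra.induction with
  | algebraMap r =>
    rw [AlgHom.commutes, ← b.neg_bracket, ← b'.neg_bracket, b.bracket_algebraMap,
      b'.bracket_algebraMap, neg_zero, map_zero, neg_zero]
  | ι x =>
    induction v using SymmetricAlgebra.induction with
    | algebraMap r =>
      rw [AlgHom.commutes, b.bracket_algebraMap, b'.bracket_algebraMap, map_zero]
    | ι y => exact hf x y
    | mul v w hv hw => simp only [leibniz, map_add, map_mul, hv, hw]
    | add v w hv hw => simp only [map_add, hv, hw]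
  | mul u w hu hw => simp only [mul_bracket, map_add, map_mul, hu, hw]
  | add u w hu hw => simp only [map_add, LinearMap.add_apply, hu, hw]

variable {A L : Type*} [CommRing A] [LieRing L] [LieAlgebra A L] [Module Aᵐᵒᵖ L]
  [IsCentralScalar A L]

theorem symmetricLinearization_bracket (u v : SymmetricAlgebra A L) :
    symmetricLinearization ((kirillovKostant A L).bracket u v) =
      (trivSqZeroExt A L).bracket (symmetricLinearization u) (symmetricLinearization v) :=
  map_bracket_symmetricAlgebra _ _ _ (fun x y => by
    simp only [kirillovKostant_ι_ι, trivSqZeroExt_bracket, symmetricLinearization_ι,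
      TrivSqZeroExt.snd_inr]) u v

theorem kirillovKostant_bracket_mem (u v : SymmetricAlgebra A L) :
    (kirillovKostant A L).bracket u v ∈ augmentationIdeal A L :=
  mem_augmentationIdeal_of_fst_symmetricLinearization_eq_zero (by
    rw [symmetricLinearization_bracket, trivSqZeroExt_bracket, TrivSqZeroExt.fst_inr])

variable (A L) in
/-- The quotient of the Poisson algebra `Sym(L)` by a power of its augmentation ideal. -/
def truncation (k : ℕ) : PoissonBracket A (SymmetricAlgebra A L ⧸ augmentationIdeal A L ^ k) :=
  (kirillovKostant A L).quotient _ fun u =>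
    bracket_mem_pow _ (fun v _ => kirillovKostant_bracket_mem u v) k

theorem truncationLinearization_bracket (k : ℕ)
    (u v : SymmetricAlgebra A L ⧸ augmentationIdeal A L ^ (k + 2)) :
    truncationLinearization A L k ((truncation A L (k + 2)).bracket u v) =
      (trivSqZeroExt A L).bracket (truncationLinearization A L k u)
        (truncationLinearization A L k v) := by
  obtain ⟨u, rfl⟩ := Ideal.Quotient.mk_surjective u
  obtain ⟨v, rfl⟩ := Ideal.Quotient.mk_surjective v
  exact symmetricLinearization_bracket u v

end PoissonBracket

/-! ### Homomorphisms out of the Poisson envelope -/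

namespace PoissonEnvelope

section

variable {R A P : Type*} [CommRing R] [CommRing A] [Algebra R A] [CommRing P] [Algebra R P]

/-- The Poisson homomorphism from `P(A)` which extends an algebra homomorphism from `A`. -/
def lift (b : PoissonBracket R P) (f : A →ₐ[R] P) : PoissonEnvelope R A →ₐ[R] P :=
  (existsUnique_lift R b f).choose

@[simp]
theorem lift_algebraMap (b : PoissonBracket R P) (f : A →ₐ[R] P) (a : A) :
    lift b f (algebraMap A _ a) = f a :=
  (existsUnique_lift R b f).choose_spec.1.1 a

theorem lift_bracket (b : PoissonBracket R P) (f : A →ₐ[R] P) (x y : PoissonEnvelope R A) :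
    lift b f ((poissonBracket R A).bracket x y) = b.bracket (lift b f x) (lift b f y) :=
  (existsUnique_lift R b f).choose_spec.1.2 x y

theorem hom_ext (b : PoissonBracket R P) {f g : PoissonEnvelope R A →ₐ[R] P}
    (hf : ∀ x y, f ((poissonBracket R A).bracket x y) = b.bracket (f x) (f y))
    (hg : ∀ x y, g ((poissonBracket R A).bracket x y) = b.bracket (g x) (g y))
    (h : ∀ a : A, f (algebraMap A _ a) = g (algebraMap A _ a)) : f = g :=
  (existsUnique_lift R b (g.comp (IsScalarTower.toAlgHom R A _))).unique ⟨h, hf⟩ ⟨fun _ => rfl, hg⟩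

end

section

variable {R A L : Type*} [CommRing R] [CommRing A] [Algebra R A] [AddCommGroup L] [Module A L]
  [Module R L] [IsScalarTower R A L] [Module Aᵐᵒᵖ L] [IsCentralScalar A L]

/-- The homomorphism `a ↦ a + ε D a` to a square-zero extension, where `D` is a derivation. -/
def derivationLift (D : Derivation R A L) : A →ₐ[R] TrivSqZeroExt A L :=
  AlgHom.ofLinearMap ((TrivSqZeroExt.inlAlgHom R A L).toLinearMap +
    (TrivSqZeroExt.inrHom A L).restrictScalars R ∘ₗ (D : A →ₗ[R] L))
    (by simp) (fun a b => by ext <;> simp [add_comm])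

end

section

variable {R A L : Type*} [CommRing R] [CommRing A] [Algebra R A] [LieRing L] [LieAlgebra A L]
  [Module R L] [IsScalarTower R A L] [Module Aᵐᵒᵖ L] [IsCentralScalar A L]

/-- The Poisson homomorphism from `P(A)` to the square-zero extension of `A` by a Lie algebra which
extends `a ↦ a + ε D a`. -/
def firstOrderLift (D : Derivation R A L) : PoissonEnvelope R A →ₐ[R] TrivSqZeroExt A L :=
  lift ((PoissonBracket.trivSqZeroExt A L).restrictScalars R) (derivationLift D)

theorem firstOrderLift_algebraMap (D : Derivation R A L) (a : A) :
    firstOrderLift D (algebraMap A _ a) = .inl a + .inr (D a) :=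
  lift_algebraMap _ _ a

theorem firstOrderLift_bracket (D : Derivation R A L) (x y : PoissonEnvelope R A) :
    firstOrderLift D ((poissonBracket R A).bracket x y) =
      .inr ⁅(firstOrderLift D x).snd, (firstOrderLift D y).snd⁆ :=
  lift_bracket _ _ x y

theorem exists_truncationLinearization_comp_eq [Algebra.FormallySmooth R A] (D : Derivation R A L)
    (k : ℕ) :
    ∃ Φ : PoissonEnvelope R A →ₐ[R] SymmetricAlgebra A L ⧸ augmentationIdeal A L ^ (k + 2),
      ((truncationLinearization A L k).restrictScalars R).comp Φ = firstOrderLift D := by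
  let π := (truncationLinearization A L k).restrictScalars R
  have hπ : Function.Surjective π := truncationLinearization_surjective A L k
  have hker : IsNilpotent (RingHom.ker π.toRingHom) := isNilpotent_ker_truncationLinearization A L k
  refine ⟨lift ((PoissonBracket.truncation A L (k + 2)).restrictScalars R)
    (Algebra.FormallySmooth.liftOfSurjective (derivationLift D) π hπ hker), ?_⟩
  refine hom_ext ((PoissonBracket.trivSqZeroExt A L).restrictScalars R) (fun x y => ?_)
    (lift_bracket _ _) fun a => ?_
  · rw [AlgHom.comp_apply, lift_bracket, PoissonBracket.restrictScalars_bracket,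
      AlgHom.restrictScalars_apply, PoissonBracket.truncationLinearization_bracket]
    rfl
  · rw [AlgHom.comp_apply, lift_algebraMap, firstOrderLift_algebraMap]
    exact Algebra.FormallySmooth.liftOfSurjective_apply _ π hπ hker a

end

end PoissonEnvelope

/-! ### The grading of the free Lie algebra -/

namespace ModuleLie

variable {A M : Type*} [CommRing A] [AddCommGroup M] [Module A M]

section

variable {L : Type*} [LieRing L] [LieAlgebra A L]

theorem hom_ext {f g : ModuleLie A M →ₗ⁅A⁆ L} (h : ∀ x, f (ι A x) = g (ι A x)) : f = g :=
  (existsUnique_lift A ((g : ModuleLie A M →ₗ[A] L) ∘ₗ ι A)).unique h fun _ => rfl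

/-- The homomorphism of Lie algebras from `Lie(M)` which extends a linear map. -/
def lift (f : M →ₗ[A] L) : ModuleLie A M →ₗ⁅A⁆ L :=
  (existsUnique_lift A f).choose

@[simp]
theorem lift_ι (f : M →ₗ[A] L) (x : M) : lift f (ι A x) = f x :=
  (existsUnique_lift A f).choose_spec.1 x

end

theorem lie_mem_degreePart {m n : ℕ} {u v : ModuleLie A M} (hu : u ∈ degreePart A M m)
    (hv : v ∈ degreePart A M n) : ⁅u, v⁆ ∈ degreePart A M (m + n) :=
  LinearMap.BilinMap.apply_apply_mem_of_mem_span (degreePart A M (m + n)) _ _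
    (LieModule.toEnd A (ModuleLie A M) (ModuleLie A M) : ModuleLie A M →ₗ[A] _)
    (fun _ hx _ hy => Submodule.subset_span (hx.lie hy)) u v hu hv

theorem span_isMonomial_eq_top :
    Submodule.span A {z : ModuleLie A M | ∃ n, IsMonomial A n z} = ⊤ := by
  let K : LieSubalgebra A (ModuleLie A M) :=
    { Submodule.span A {z : ModuleLie A M | ∃ n, IsMonomial A n z} with
      lie_mem' {x y} := LinearMap.BilinMap.apply_apply_mem_of_mem_span
        (Submodule.span A {z : ModuleLie A M | ∃ n, IsMonomial A n z}) _ _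
        (LieModule.toEnd A (ModuleLie A M) (ModuleLie A M) : ModuleLie A M →ₗ[A] _)
        (by rintro x ⟨m, hx⟩ y ⟨n, hy⟩; exact Submodule.subset_span ⟨m + n, hx.lie hy⟩) x y }
  let toK : ModuleLie A M →ₗ⁅A⁆ K :=
    lift ((ι A).codRestrict K.toSubmodule fun x => Submodule.subset_span ⟨1, .ι x⟩)
  have hid : K.incl.comp toK = LieHom.id := hom_ext fun x => by
    rw [LieHom.comp_apply, lift_ι]
    rfl
  refine Submodule.eq_top_iff'.2 fun z => ?_
  have hz : (toK z : ModuleLie A M) = z := LieHom.congr_fun hid z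
  exact hz ▸ (toK z).2

theorem iSup_degreePart : ⨆ n, degreePart A M n = ⊤ := by
  rw [eq_top_iff, ← span_isMonomial_eq_top, Submodule.span_le]
  rintro z ⟨n, hz⟩
  exact Submodule.mem_iSup_of_mem n (Submodule.subset_span hz)

variable (A M) in
/-- The homomorphism `x ↦ t x` from `Lie(M)` to the polynomial loop algebra `A[t] ⊗ Lie(M)`. -/
def loopMap : ModuleLie A M →ₗ⁅A⁆ LieAlgebra.loopAlgebra A ℕ (ModuleLie A M) :=
  lift (TensorProduct.mk A (AddMonoidAlgebra A ℕ) (ModuleLie A M)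
    (AddMonoidAlgebra.single 1 1) ∘ₗ ι A)

theorem loopMap_of_isMonomial {n : ℕ} {z : ModuleLie A M} (hz : IsMonomial A n z) :
    loopMap A M z = AddMonoidAlgebra.single n (1 : A) ⊗ₜ z := by
  induction hz with
  | ι x => simp [loopMap]
  | lie _ _ hx hy =>
    rw [LieHom.map_lie, hx, hy, LieAlgebra.ExtendScalars.bracket_tmul,
      AddMonoidAlgebra.single_mul_single, one_mul]

/-- The homogeneous components of an element of `Lie(M)`, read off from its image in the loop
algebra. -/
def components : ModuleLie A M →ₗ[A] ℕ →₀ ModuleLie A M :=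
  (LieAlgebra.LoopAlgebra.toFinsupp A ℕ (ModuleLie A M)).toLinearMap ∘ₗ loopMap A M

theorem components_of_mem_degreePart {n : ℕ} {z : ModuleLie A M} (hz : z ∈ degreePart A M n) :
    components z = Finsupp.single n z := by
  refine LinearMap.eqOn_span (g := Finsupp.lsingle n) (fun x hx => ?_) hz
  rw [components, LinearMap.comp_apply, LieHom.coe_toLinearMap, loopMap_of_isMonomial hx]
  exact LieAlgebra.LoopAlgebra.toFinsupp_single_tmul ..

theorem components_coeLinearMap (x : DirectSum ℕ fun n => degreePart A M n) (n : ℕ) :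
    components (DirectSum.coeLinearMap (degreePart A M) x) n = x n := by
  induction x using DirectSum.induction_on with
  | zero => simp
  | of i y =>
    rw [DirectSum.coeLinearMap_of, components_of_mem_degreePart y.2, Finsupp.single_apply,
      DirectSum.coe_of_apply, apply_ite Subtype.val]
    rfl
  | add x y hx hy => simp only [map_add, Finsupp.add_apply, hx, hy, DirectSum.add_apply,
      Submodule.coe_add]

theorem isInternal_degreePart : DirectSum.IsInternal (degreePart A M) := by
  refine ⟨fun x y hxy => DFinsupp.ext fun n => Subtype.ext ?_, ?_⟩
  · rw [← components_coeLinearMap, ← components_coeLinearMap]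
    exact congrArg (fun z => components z n) hxy
  · have hrange := (DirectSum.range_coeLinearMap (A := degreePart A M)).trans iSup_degreePart
    exact LinearMap.range_eq_top.1 hrange

end ModuleLie

namespace LiePlus

open ModuleLie

variable (A M : Type*) [CommRing A] [AddCommGroup M] [Module A M]

/-- The canonical map from `Lie_{≥ 2}(M)` to `Lie(M)`. -/
def incl : LiePlus A M →ₗ[A] ModuleLie A M :=
  DirectSum.coeLinearMap fun i => degreePart A M (i + 2)

variable {A M} in
theorem incl_lof (i : ℕ) (y : degreePart A M (i + 2)) :
    incl A M (DirectSum.lof A ℕ (fun i => degreePart A M (i + 2)) i y) = y :=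
  DirectSum.coeLinearMap_lof ..

/-- The projection of `Lie(M)` to `Lie_{≥ 2}(M)`. -/
def proj : ModuleLie A M →ₗ[A] LiePlus A M :=
  DirectSum.toModule A ℕ (LiePlus A M) (fun n => match n with
    | 0 => 0
    | 1 => 0
    | i + 2 => DirectSum.lof A ℕ (fun i => degreePart A M (i + 2)) i) ∘ₗ
  (LinearEquiv.ofBijective (DirectSum.coeLinearMap (degreePart A M))
    isInternal_degreePart).symm.toLinearMap

theorem proj_comp_incl : proj A M ∘ₗ incl A M = LinearMap.id := by
  ext i y : 2
  have hy : (LinearEquiv.ofBijective (DirectSum.coeLinearMap (degreePart A M))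
      isInternal_degreePart).symm y = DirectSum.lof A ℕ (degreePart A M ·) (i + 2) y := by
    rw [LinearEquiv.symm_apply_eq]
    exact (DirectSum.coeLinearMap_lof ..).symm
  rw [LinearMap.comp_apply, LinearMap.comp_apply, incl_lof, proj, LinearMap.comp_apply,
    LinearEquiv.coe_coe, hy]
  exact DirectSum.toModule_lof ..

end LiePlus

/-! ### Poisson algebras as Lie algebras -/

namespace PoissonBracket

variable {R P : Type*} [CommRing R] [CommRing P] [Algebra R P] (b : PoissonBracket R P)

/-- The Lie algebra underlying a Poisson algebra. It is a type synonym because the ring `P` itself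
carries the commutator bracket. -/
def AsLie (_ : PoissonBracket R P) : Type _ := P

instance : LieRing b.AsLie where
  __ := (inferInstanceAs (AddCommGroup P) : AddCommGroup b.AsLie)
  bracket x y := b.bracket x y
  add_lie x y z := LinearMap.map_add₂ b.bracket x y z
  lie_add x y z := map_add (b.bracket x) y z
  lie_self := b.bracket_self
  leibniz_lie := b.jacobi

instance : LieAlgebra R b.AsLie where
  __ := (inferInstanceAs (Module R P) : Module R b.AsLie)
  lie_smul r x y := map_smul (b.bracket x) r y

/-- The identity map from a Poisson algebra to its underlying Lie algebra. -/
def toLie : P ≃ₗ[R] b.AsLie := LinearEquiv.refl R P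

theorem tmul_lie_tmul {A : Type*} [CommRing A] [Algebra R A] (c e : A) (x y : P) :
    ⁅c ⊗ₜ[R] b.toLie x, e ⊗ₜ[R] b.toLie y⁆ = (c * e) ⊗ₜ[R] b.toLie (b.bracket x y) :=
  rfl

theorem mul_bracket_mul (c x e y : P) :
    b.bracket (c * x) (e * y) = c * e * b.bracket x y +
      (c * (b.bracket x e * y) + e * (b.bracket c y * x) + b.bracket c e * (x * y)) := by
  rw [b.mul_bracket, b.leibniz, b.leibniz]
  ring

section

variable (A : Type*) [CommRing A] [Algebra R A] [Algebra A P] [IsScalarTower R A P]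

/-- The multiplication map from the extension of scalars of a Poisson `R`-algebra `P` to an
`R`-algebra `A` over which `P` is an algebra. It is not a homomorphism of Lie algebras. -/
def scalarMul : A ⊗[R] b.AsLie →ₗ[A] P :=
  LinearMap.liftBaseChange A b.toLie.symm.toLinearMap

variable {A} in
@[simp]
theorem scalarMul_tmul (c : A) (x : P) : b.scalarMul A (c ⊗ₜ b.toLie x) = c • x :=
  LinearMap.liftBaseChange_tmul ..

end

end PoissonBracket

/-! ### The grading of the Poisson envelope -/

namespace PoissonEnvelope

variable {R A : Type*} [CommRing R] [CommRing A] [Algebra R A]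

theorem IsMonomial.smul {n : ℕ} {x : PoissonEnvelope R A} (hx : IsMonomial R n x) (a : A) :
    IsMonomial R n (a • x) := by
  simpa only [zero_add, Algebra.smul_def] using (IsMonomial.of (R := R) a).mul hx

theorem IsMonomial.mem {n : ℕ} {x : PoissonEnvelope R A} (hx : IsMonomial R n x) :
    x ∈ degreePart R A n :=
  Submodule.subset_span hx

@[elab_as_elim]
theorem degreePart_induction {n : ℕ} {p : (x : PoissonEnvelope R A) → x ∈ degreePart R A n → Prop}
    (mem : ∀ x (hx : IsMonomial R n x), p x hx.mem) (zero : p 0 (zero_mem _))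
    (add : ∀ x y hx hy, p x hx → p y hy → p (x + y) (add_mem hx hy))
    {x : PoissonEnvelope R A} (hx : x ∈ degreePart R A n) : p x hx := by
  induction hx using Submodule.closure_induction with
  | zero => exact zero
  | add x y hx hy hpx hpy => exact add x y hx hy hpx hpy
  | smul_mem a x hx => exact mem _ (hx.smul a)

theorem mul_mem_degreePart {m n : ℕ} {x y : PoissonEnvelope R A} (hx : x ∈ degreePart R A m)
    (hy : y ∈ degreePart R A n) : x * y ∈ degreePart R A (m + n) :=
  LinearMap.BilinMap.apply_apply_mem_of_mem_span (degreePart R A (m + n)) _ _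
    (LinearMap.mul A (PoissonEnvelope R A)) (fun _ hx _ hy => (hx.mul hy).mem) x y hx hy

theorem bracket_mem_degreePart {m n : ℕ} {x y : PoissonEnvelope R A} (hx : x ∈ degreePart R A m)
    (hy : y ∈ degreePart R A n) :
    (poissonBracket R A).bracket x y ∈ degreePart R A (m + n + 1) := by
  induction hx using degreePart_induction with
  | mem x hx =>
    induction hy using degreePart_induction with
    | mem y hy => exact (hx.bracket hy).mem
    | zero => simp
    | add y z _ _ hy hz => rw [map_add]; exact add_mem hy hz
  | zero => simp
  | add y z _ _ hy hz => rw [LinearMap.map_add₂]; exact add_mem hy hz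

theorem algebraMap_mem_degreePart (a : A) :
    algebraMap A (PoissonEnvelope R A) a ∈ degreePart R A 0 :=
  (IsMonomial.of a).mem

theorem prod_mem_degreePart {k : ℕ} (n : Fin k → ℕ) (x : Fin k → PoissonEnvelope R A)
    (hx : ∀ j, x j ∈ degreePart R A (n j)) : ∏ j, x j ∈ degreePart R A (∑ j, n j) := by
  induction k with
  | zero => simpa using algebraMap_mem_degreePart (R := R) (1 : A)
  | succ k ih =>
    rw [Fin.prod_univ_succ, Fin.sum_univ_succ]
    exact mul_mem_degreePart (hx 0) (ih _ _ fun j => hx j.succ)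

theorem IsMonomial.exists_algebraMap_eq {n : ℕ} {x : PoissonEnvelope R A}
    (hx : IsMonomial R n x) (hn : n = 0) : ∃ a : A, algebraMap A (PoissonEnvelope R A) a = x := by
  induction hx with
  | of a => exact ⟨a, rfl⟩
  | mul _ _ ihx ihy =>
    obtain ⟨a, rfl⟩ := ihx (by omega)
    obtain ⟨b, rfl⟩ := ihy (by omega)
    exact ⟨a * b, map_mul ..⟩
  | bracket => omega

variable (R A) in
/-- The part of `P^n(A)` spanned by the products of two elements of positive degree. -/
def decomposables (n : ℕ) : Submodule A (PoissonEnvelope R A) :=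
  Submodule.span A {z | ∃ e f x y, e + f + 2 = n ∧ x ∈ degreePart R A (e + 1) ∧
    y ∈ degreePart R A (f + 1) ∧ z = x * y}

theorem mul_mem_decomposables {m n d : ℕ} {x y : PoissonEnvelope R A}
    (hx : x ∈ degreePart R A m) (hy : y ∈ degreePart R A n) (hm : m ≠ 0) (hn : n ≠ 0)
    (hd : m + n = d) : x * y ∈ decomposables R A d := by
  obtain ⟨m, rfl⟩ := Nat.exists_eq_succ_of_ne_zero hm
  obtain ⟨n, rfl⟩ := Nat.exists_eq_succ_of_ne_zero hn
  exact Submodule.subset_span ⟨m, n, x, y, by omega, hx, hy, rfl⟩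

theorem bracket_mem_decomposables {m n : ℕ} {u z : PoissonEnvelope R A}
    (hu : u ∈ degreePart R A m) (hz : z ∈ decomposables R A n) :
    (poissonBracket R A).bracket u z ∈ decomposables R A (m + n + 1) := by
  induction hz using Submodule.closure_induction with
  | zero => simp
  | add x y _ _ hx hy => rw [map_add]; exact add_mem hx hy
  | smul_mem a z hz =>
    obtain ⟨e, f, x, y, h, hx, hy, rfl⟩ := hz
    have hax := Submodule.smul_mem _ a hx
    rw [← smul_mul_assoc, (poissonBracket R A).leibniz]
    exact add_mem
      (mul_mem_decomposables (bracket_mem_degreePart hu hax) hy (by omega) (by omega) (by omega))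
      (mul_mem_decomposables hax (bracket_mem_degreePart hu hy) (by omega) (by omega) (by omega))

theorem bracket_mem_decomposables_of_left {m n : ℕ} {u z : PoissonEnvelope R A}
    (hz : z ∈ decomposables R A m) (hu : u ∈ degreePart R A n) :
    (poissonBracket R A).bracket z u ∈ decomposables R A (m + n + 1) := by
  rw [← (poissonBracket R A).neg_bracket, add_comm m]
  exact neg_mem (bracket_mem_decomposables hu hz)

/-! ### The extension of scalars of the Lie algebra `P(A)` -/

variable (R A) in
/-- The extension of scalars `A ⊗ P(A)` of the Lie algebra underlying the Poisson envelope. -/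
abbrev ExtendedLie : Type _ := A ⊗[R] (poissonBracket R A).AsLie

variable (R A) in
/-- The part of the extension of scalars `A ⊗ P(A)` which is generated by `P^n(A)`. -/
def extendedPart (n : ℕ) : Submodule A (ExtendedLie R A) :=
  Submodule.span A {s | ∃ x, IsMonomial R n x ∧ s = 1 ⊗ₜ (poissonBracket R A).toLie x}

theorem tmul_mem_extendedPart {n : ℕ} (c : A) {x : PoissonEnvelope R A} (hx : IsMonomial R n x) :
    c ⊗ₜ (poissonBracket R A).toLie x ∈ extendedPart R A n := by
  rw [← mul_one c, ← smul_eq_mul, ← TensorProduct.smul_tmul']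
  exact Submodule.smul_mem _ _ (Submodule.subset_span ⟨x, hx, rfl⟩)

@[elab_as_elim]
theorem extendedPart_induction {n : ℕ}
    {p : (s : ExtendedLie R A) → s ∈ extendedPart R A n → Prop}
    (mem : ∀ (c : A) x (hx : IsMonomial R n x), p (c ⊗ₜ (poissonBracket R A).toLie x)
      (tmul_mem_extendedPart c hx))
    (zero : p 0 (zero_mem _)) (add : ∀ s t hs ht, p s hs → p t ht → p (s + t) (add_mem hs ht))
    {s : ExtendedLie R A} (hs : s ∈ extendedPart R A n) : p s hs := by
  induction hs using Submodule.closure_induction with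
  | zero => exact zero
  | add x y hx hy hpx hpy => exact add x y hx hy hpx hpy
  | smul_mem a x hx =>
    obtain ⟨x, hx, rfl⟩ := hx
    simp only [TensorProduct.smul_tmul', smul_eq_mul, mul_one]
    exact mem a x hx

theorem lie_mem_extendedPart {m n : ℕ} {s t : ExtendedLie R A}
    (hs : s ∈ extendedPart R A m) (ht : t ∈ extendedPart R A n) :
    ⁅s, t⁆ ∈ extendedPart R A (m + n + 1) := by
  refine LinearMap.BilinMap.apply_apply_mem_of_mem_span (extendedPart R A (m + n + 1)) _ _
    (LieModule.toEnd A (ExtendedLie R A) (ExtendedLie R A) : ExtendedLie R A →ₗ[A] _) ?_ s t hs ht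
  rintro _ ⟨x, hx, rfl⟩ _ ⟨y, hy, rfl⟩
  exact Set.mem_of_eq_of_mem (PoissonBracket.tmul_lie_tmul _ 1 1 x y)
    (tmul_mem_extendedPart _ (hx.bracket hy))

theorem scalarMul_mem {n : ℕ} {s : ExtendedLie R A}
    (hs : s ∈ extendedPart R A n) : (poissonBracket R A).scalarMul A s ∈ degreePart R A n := by
  induction hs using extendedPart_induction with
  | mem c x hx =>
    exact (PoissonBracket.scalarMul_tmul (poissonBracket R A) c x).symm ▸ (hx.smul c).mem
  | zero => simp
  | add s t _ _ hs ht => rw [map_add]; exact add_mem hs ht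

theorem bracket_smul_smul_sub_mem {m n : ℕ} (hm : m ≠ 0) (hn : n ≠ 0) (c e : A)
    {x y : PoissonEnvelope R A} (hx : x ∈ degreePart R A m) (hy : y ∈ degreePart R A n) :
    (poissonBracket R A).bracket (c • x) (e • y) - (c * e) • (poissonBracket R A).bracket x y ∈
      decomposables R A (m + n + 1) := by
  have hc : algebraMap A (PoissonEnvelope R A) c ∈ degreePart R A 0 := algebraMap_mem_degreePart c
  have he : algebraMap A (PoissonEnvelope R A) e ∈ degreePart R A 0 := algebraMap_mem_degreePart e
  rw [Algebra.smul_def, Algebra.smul_def, Algebra.smul_def, map_mul (algebraMap ..),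
    (poissonBracket R A).mul_bracket_mul, add_sub_cancel_left, ← Algebra.smul_def,
    ← Algebra.smul_def]
  refine add_mem (add_mem (Submodule.smul_mem _ _ ?_) (Submodule.smul_mem _ _ ?_)) ?_
  · exact mul_mem_decomposables (bracket_mem_degreePart hx he) hy (by omega) hn (by omega)
  · exact mul_mem_decomposables (bracket_mem_degreePart hc hy) hx (by omega) hm (by omega)
  · exact mul_mem_decomposables (bracket_mem_degreePart hc he) (mul_mem_degreePart hx hy)
      (by omega) (by omega) (by omega)

theorem bracket_scalarMul_sub_mem {m n : ℕ} (hm : m ≠ 0) (hn : n ≠ 0)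
    {s t : ExtendedLie R A} (hs : s ∈ extendedPart R A m)
    (ht : t ∈ extendedPart R A n) :
    (poissonBracket R A).bracket ((poissonBracket R A).scalarMul A s)
        ((poissonBracket R A).scalarMul A t) - (poissonBracket R A).scalarMul A ⁅s, t⁆ ∈
      decomposables R A (m + n + 1) := by
  induction hs using extendedPart_induction with
  | zero => simp
  | add s s' _ _ hs hs' =>
    rw [map_add, LinearMap.map_add₂, add_lie, map_add, add_sub_add_comm]
    exact add_mem hs hs'
  | mem c x hx =>
    induction ht using extendedPart_induction with
    | zero => simp
    | add t t' _ _ ht ht' =>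
      rw [map_add, map_add, lie_add, map_add, add_sub_add_comm]
      exact add_mem ht ht'
    | mem e y hy => exact bracket_smul_smul_sub_mem hm hn c e hx.mem hy.mem

end PoissonEnvelope

section

variable {R A : Type*} [CommRing R] [CommRing A] [Algebra R A]

theorem exists_liftBaseChange_D_comp_eq_id [Module.Projective A (KaehlerDifferential R A)] :
    ∃ τ : KaehlerDifferential R A →ₗ[A] A ⊗[R] A,
      (KaehlerDifferential.D R A : A →ₗ[R] _).liftBaseChange A ∘ₗ τ = LinearMap.id := by
  refine Module.projective_lifting_property _ _ (LinearMap.range_eq_top.1 (top_unique ?_))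
  rw [← KaehlerDifferential.span_range_derivation, Submodule.span_le]
  rintro _ ⟨a, rfl⟩
  exact ⟨1 ⊗ₜ a, by simp⟩

theorem liftBaseChange_comp_eq_liftKaehlerDifferential {N : Type*} [AddCommGroup N] [Module R N]
    [Module A N] [IsScalarTower R A N] {τ : KaehlerDifferential R A →ₗ[A] A ⊗[R] A}
    (hτ : (KaehlerDifferential.D R A : A →ₗ[R] _).liftBaseChange A ∘ₗ τ = LinearMap.id)
    (δ : Derivation R A N) :
    (δ : A →ₗ[R] N).liftBaseChange A ∘ₗ τ = δ.liftKaehlerDifferential := by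
  have hδ : (δ : A →ₗ[R] N).liftBaseChange A =
      δ.liftKaehlerDifferential ∘ₗ (KaehlerDifferential.D R A : A →ₗ[R] _).liftBaseChange A := by
    ext a
    simp
  rw [hδ, LinearMap.comp_assoc, hτ, LinearMap.comp_id]

end

/-! ### The free Lie algebra of the Kähler differentials and the Poisson envelope -/

namespace PoissonEnvelope

open ModuleLie (ι)

section

variable {R A : Type*} [CommRing R] [CommRing A] [Algebra R A]

/-- The derivation `a ↦ {x, a}` from `A` to `P(A)`. -/
def bracketDerivation (x : PoissonEnvelope R A) : Derivation R A (PoissonEnvelope R A) :=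
  ((poissonBracket R A).hamiltonian x).compAlgebraMap A

theorem bracketDerivation_apply (x : PoissonEnvelope R A) (a : A) :
    bracketDerivation x a = (poissonBracket R A).bracket x (algebraMap A _ a) :=
  rfl

variable (τ : KaehlerDifferential R A →ₗ[A] A ⊗[R] A)

variable (R A) in
/-- The inclusion of the scalar extension of `A` in that of `P(A)`. -/
def extendedOfHom : A ⊗[R] A →ₗ[A] ExtendedLie R A :=
  ((poissonBracket R A).toLie.toLinearMap ∘ₗ
    (IsScalarTower.toAlgHom R A (PoissonEnvelope R A)).toLinearMap).baseChange A

theorem extendedOfHom_tmul (c a : A) :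
    extendedOfHom R A (c ⊗ₜ a) = c ⊗ₜ (poissonBracket R A).toLie (algebraMap A _ a) :=
  rfl

/-- The homomorphism of Lie algebras from `Lie(Ω)` to the scalar extension of `P(A)` which is
determined by a choice `τ` of representatives `∑ c ⊗ a` for the differential forms `∑ c da`. -/
def lieHom : ModuleLie A (KaehlerDifferential R A) →ₗ⁅A⁆ ExtendedLie R A :=
  ModuleLie.lift (extendedOfHom R A ∘ₗ τ)

theorem lieHom_ι (ω : KaehlerDifferential R A) :
    lieHom τ (ι A ω) = extendedOfHom R A (τ ω) :=
  ModuleLie.lift_ι _ _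

theorem extendedOfHom_mem (t : A ⊗[R] A) : extendedOfHom R A t ∈ extendedPart R A 0 := by
  induction t with
  | zero => simp
  | tmul c a => exact tmul_mem_extendedPart c (.of a)
  | add s t hs ht => rw [map_add]; exact add_mem hs ht

theorem lieHom_mem_of_isMonomial {n : ℕ} {z : ModuleLie A (KaehlerDifferential R A)}
    (hz : ModuleLie.IsMonomial A n z) : ∃ m, n = m + 1 ∧ lieHom τ z ∈ extendedPart R A m := by
  induction hz with
  | ι ω => exact ⟨0, rfl, (lieHom_ι τ ω).symm ▸ extendedOfHom_mem _⟩
  | lie _ _ hx hy =>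
    obtain ⟨m, rfl, hx⟩ := hx
    obtain ⟨n, rfl, hy⟩ := hy
    refine ⟨m + n + 1, by omega, ?_⟩
    rw [LieHom.map_lie]
    exact lie_mem_extendedPart hx hy

theorem lieHom_mem {n : ℕ} {z : ModuleLie A (KaehlerDifferential R A)}
    (hz : z ∈ ModuleLie.degreePart A (KaehlerDifferential R A) (n + 1)) :
    lieHom τ z ∈ extendedPart R A n := by
  have hle : ModuleLie.degreePart A (KaehlerDifferential R A) (n + 1) ≤
      (extendedPart R A n).comap (lieHom τ : _ →ₗ[A] ExtendedLie R A) := by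
    refine Submodule.span_le.2 fun z hz => ?_
    obtain ⟨m, h, hz⟩ := lieHom_mem_of_isMonomial τ hz
    obtain rfl := Nat.succ_injective h
    exact hz
  exact hle hz

/-- The linear map from `Lie(Ω)` to `P(A)` which is determined by a choice of representatives of
differential forms. -/
def lieMap : ModuleLie A (KaehlerDifferential R A) →ₗ[A] PoissonEnvelope R A :=
  (poissonBracket R A).scalarMul A ∘ₗ (lieHom τ : _ →ₗ[A] ExtendedLie R A)

theorem lieMap_apply (z : ModuleLie A (KaehlerDifferential R A)) :
    lieMap τ z = (poissonBracket R A).scalarMul A (lieHom τ z) :=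
  rfl

theorem lieMap_mem {n : ℕ} {z : ModuleLie A (KaehlerDifferential R A)}
    (hz : z ∈ ModuleLie.degreePart A (KaehlerDifferential R A) (n + 1)) :
    lieMap τ z ∈ degreePart R A n :=
  scalarMul_mem (lieHom_mem τ hz)

theorem bracket_lieMap_sub_mem {m n : ℕ} (hm : m ≠ 0) (hn : n ≠ 0)
    {u v : ModuleLie A (KaehlerDifferential R A)}
    (hu : u ∈ ModuleLie.degreePart A (KaehlerDifferential R A) (m + 1))
    (hv : v ∈ ModuleLie.degreePart A (KaehlerDifferential R A) (n + 1)) :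
    (poissonBracket R A).bracket (lieMap τ u) (lieMap τ v) - lieMap τ ⁅u, v⁆ ∈
      decomposables R A (m + n + 1) := by
  rw [lieMap_apply _ ⁅u, v⁆, LieHom.map_lie]
  exact bracket_scalarMul_sub_mem hm hn (lieHom_mem τ hu) (lieHom_mem τ hv)

theorem scalarMul_tmul_lie_extendedOfHom (c : A) (x : PoissonEnvelope R A) (t : A ⊗[R] A) :
    (poissonBracket R A).scalarMul A ⁅c ⊗ₜ[R] (poissonBracket R A).toLie x, extendedOfHom R A t⁆ =
      c • (bracketDerivation x : A →ₗ[R] PoissonEnvelope R A).liftBaseChange A t := by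
  induction t with
  | zero => rw [map_zero, map_zero, lie_zero, map_zero, smul_zero]
  | tmul e a =>
    rw [extendedOfHom_tmul, PoissonBracket.tmul_lie_tmul, PoissonBracket.scalarMul_tmul,
      LinearMap.liftBaseChange_tmul, mul_smul]
    rfl
  | add s t hs ht => rw [map_add, map_add, lie_add, map_add, hs, ht, smul_add]

end

section

variable {R A : Type*} [CommRing R] [CommRing A] [Algebra R A]
  {τ : KaehlerDifferential R A →ₗ[A] A ⊗[R] A}
  (hτ : (KaehlerDifferential.D R A : A →ₗ[R] _).liftBaseChange A ∘ₗ τ = LinearMap.id)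

include hτ

theorem liftBaseChange_bracketDerivation_section_D (x : PoissonEnvelope R A) (a : A) :
    (bracketDerivation x : A →ₗ[R] PoissonEnvelope R A).liftBaseChange A
      (τ (KaehlerDifferential.D R A a)) =
      (poissonBracket R A).bracket x (algebraMap A _ a) := by
  have h := LinearMap.congr_fun
    (liftBaseChange_comp_eq_liftKaehlerDifferential hτ (bracketDerivation x))
    (KaehlerDifferential.D R A a)
  rwa [Derivation.liftKaehlerDifferential_comp_D, bracketDerivation_apply] at h

theorem scalarMul_tmul_lie_lieHom_ι_D (c a : A) (x : PoissonEnvelope R A) :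
    (poissonBracket R A).scalarMul A ⁅c ⊗ₜ[R] (poissonBracket R A).toLie x,
      lieHom τ (ι A (KaehlerDifferential.D R A a))⁆ =
      c • (poissonBracket R A).bracket x (algebraMap A _ a) := by
  rw [lieHom_ι, scalarMul_tmul_lie_extendedOfHom, liftBaseChange_bracketDerivation_section_D hτ]

theorem lieMap_lie_D (a b : A) :
    lieMap τ ⁅ι A (KaehlerDifferential.D R A a), ι A (KaehlerDifferential.D R A b)⁆ =
      (poissonBracket R A).bracket (algebraMap A _ a) (algebraMap A _ b) := by
  have hneg (t : A ⊗[R] A) : (poissonBracket R A).scalarMul A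
      ⁅extendedOfHom R A t, lieHom τ (ι A (KaehlerDifferential.D R A b))⁆ =
      -(bracketDerivation (algebraMap A (PoissonEnvelope R A) b) :
        A →ₗ[R] PoissonEnvelope R A).liftBaseChange A t := by
    induction t with
    | zero => rw [map_zero, map_zero, zero_lie, map_zero, neg_zero]
    | tmul c e =>
      rw [extendedOfHom_tmul, scalarMul_tmul_lie_lieHom_ι_D hτ, LinearMap.liftBaseChange_tmul,
        ← smul_neg, ← (poissonBracket R A).neg_bracket]
      rfl
    | add s t hs ht => rw [map_add, map_add, add_lie, map_add, hs, ht, neg_add]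
  rw [lieMap_apply, LieHom.map_lie, lieHom_ι τ (KaehlerDifferential.D R A a), hneg,
    liftBaseChange_bracketDerivation_section_D hτ, (poissonBracket R A).neg_bracket]

theorem bracket_lieMap_algebraMap_sub_mem {n : ℕ} (hn : n ≠ 0)
    {z : ModuleLie A (KaehlerDifferential R A)}
    (hz : z ∈ ModuleLie.degreePart A (KaehlerDifferential R A) (n + 1)) (a : A) :
    (poissonBracket R A).bracket (lieMap τ z) (algebraMap A _ a) -
      lieMap τ ⁅z, ι A (KaehlerDifferential.D R A a)⁆ ∈ decomposables R A (n + 1) := by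
  rw [lieMap_apply, lieMap_apply, LieHom.map_lie]
  have hs := lieHom_mem τ hz
  generalize lieHom τ z = s at hs ⊢
  induction hs using extendedPart_induction with
  | zero => rw [map_zero, map_zero, zero_lie, map_zero, sub_zero]; exact zero_mem _
  | add s s' _ _ hs hs' =>
    rw [map_add, LinearMap.map_add₂, add_lie, map_add, add_sub_add_comm]
    exact add_mem hs hs'
  | mem c x hx =>
    rw [scalarMul_tmul_lie_lieHom_ι_D hτ, PoissonBracket.scalarMul_tmul, Algebra.smul_def,
      (poissonBracket R A).mul_bracket, Algebra.smul_def, add_sub_cancel_left]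
    exact mul_mem_decomposables (bracket_mem_degreePart (algebraMap_mem_degreePart c)
      (algebraMap_mem_degreePart a)) hx.mem (by omega) hn (by omega)

end

end PoissonEnvelope

/-! ### Surjectivity -/

namespace QPart

variable {A M : Type*} [CommRing A] [AddCommGroup M] [Module A M]

theorem eq_span_sigma (d : ℕ) : QPart A M d = Submodule.span A
    {z | ∃ (k : ℕ) (y : Fin k → Σ i, ModuleLie.degreePart A M (i + 2)), ∑ j, ((y j).1 + 1) = d ∧
      z = ∏ j, SymmetricAlgebra.ι A (LiePlus A M)
        (DirectSum.lof A ℕ (fun i => ModuleLie.degreePart A M (i + 2)) (y j).1 (y j).2)} := by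
  refine congrArg _ (Set.ext fun z => ⟨?_, ?_⟩)
  · rintro ⟨k, n, y, h, rfl⟩
    exact ⟨k, fun j => ⟨n j, y j⟩, h, rfl⟩
  · rintro ⟨k, y, h, rfl⟩
    exact ⟨k, fun j => (y j).1, fun j => (y j).2, h, rfl⟩

theorem one_mem : (1 : SymmetricAlgebra A (LiePlus A M)) ∈ QPart A M 0 :=
  Submodule.subset_span ⟨0, Fin.elim0, fun j => j.elim0, rfl, rfl⟩

theorem ι_lof_mem {i : ℕ} (y : ModuleLie.degreePart A M (i + 2)) :
    SymmetricAlgebra.ι A (LiePlus A M)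
      (DirectSum.lof A ℕ (fun i => ModuleLie.degreePart A M (i + 2)) i y) ∈ QPart A M (i + 1) :=
  Submodule.subset_span ⟨1, fun _ => i, fun _ => y, by simp, by simp⟩

theorem mul_mem {m n : ℕ} {x y : SymmetricAlgebra A (LiePlus A M)} (hx : x ∈ QPart A M m)
    (hy : y ∈ QPart A M n) : x * y ∈ QPart A M (m + n) := by
  rw [eq_span_sigma] at hx hy ⊢
  have h := Submodule.mul_mem_mul hx hy
  rw [Submodule.span_mul_span] at h
  refine Submodule.span_mono ?_ h
  rintro _ ⟨_, ⟨k, y, rfl, rfl⟩, _, ⟨l, z, rfl, rfl⟩, rfl⟩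
  refine ⟨k + l, Fin.append y z, by simp [Fin.sum_univ_add], ?_⟩
  rw [Fin.prod_univ_add]
  exact congrArg₂ _ (Finset.prod_congr rfl fun i _ => by rw [Fin.append_left])
    (Finset.prod_congr rfl fun i _ => by rw [Fin.append_right])

end QPart

namespace PoissonEnvelope

open ModuleLie (ι)

section

variable {R A : Type*} [CommRing R] [CommRing A] [Algebra R A]
  (τ : KaehlerDifferential R A →ₗ[A] A ⊗[R] A)

theorem decomposables_le_degreePart (n : ℕ) : decomposables R A n ≤ degreePart R A n := by
  refine Submodule.span_le.2 ?_
  rintro _ ⟨e, f, x, y, rfl, hx, hy, rfl⟩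
  rw [show e + f + 2 = e + 1 + (f + 1) by omega]
  exact mul_mem_degreePart hx hy

/-- The sum of the image of `Lie^{n+1}(Ω)` in `P(A)` and of the decomposable elements of
degree `n`. -/
def liePart (n : ℕ) : Submodule A (PoissonEnvelope R A) :=
  (ModuleLie.degreePart A (KaehlerDifferential R A) (n + 1)).map (lieMap τ) ⊔ decomposables R A n

theorem lieMap_mem_liePart {n : ℕ} {z : ModuleLie A (KaehlerDifferential R A)}
    (hz : z ∈ ModuleLie.degreePart A (KaehlerDifferential R A) (n + 1)) :
    lieMap τ z ∈ liePart τ n :=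
  Submodule.mem_sup_left (Submodule.mem_map_of_mem hz)

theorem decomposables_le_liePart (n : ℕ) : decomposables R A n ≤ liePart τ n :=
  le_sup_right

theorem liePart_le_degreePart (n : ℕ) : liePart τ n ≤ degreePart R A n :=
  sup_le (Submodule.map_le_iff_le_comap.2 fun _ => lieMap_mem τ) (decomposables_le_degreePart n)

theorem bracket_mem_liePart {m n : ℕ} (hm : m ≠ 0) (hn : n ≠ 0) {x y : PoissonEnvelope R A}
    (hx : x ∈ liePart τ m) (hy : y ∈ liePart τ n) :
    (poissonBracket R A).bracket x y ∈ liePart τ (m + n + 1) := by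
  have hy' := liePart_le_degreePart τ n hy
  obtain ⟨_, ⟨u, hu, rfl⟩, p, hp, rfl⟩ := Submodule.mem_sup.1 hx
  obtain ⟨_, ⟨v, hv, rfl⟩, q, hq, rfl⟩ := Submodule.mem_sup.1 hy
  have huv : ⁅u, v⁆ ∈ ModuleLie.degreePart A (KaehlerDifferential R A) (m + n + 1 + 1) := by
    rw [show m + n + 1 + 1 = m + 1 + (n + 1) by omega]
    exact ModuleLie.lie_mem_degreePart hu hv
  rw [LinearMap.map_add₂, map_add ((poissonBracket R A).bracket (lieMap τ u))]
  refine add_mem (add_mem ?_ ?_) ?_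
  · rw [← add_sub_cancel (lieMap τ ⁅u, v⁆) ((poissonBracket R A).bracket _ _)]
    exact add_mem (lieMap_mem_liePart τ huv)
      (decomposables_le_liePart τ _ (bracket_lieMap_sub_mem τ hm hn hu hv))
  · exact decomposables_le_liePart τ _ (bracket_mem_decomposables (lieMap_mem τ hu) hq)
  · exact decomposables_le_liePart τ _ (bracket_mem_decomposables_of_left hp hy')

/-- The homomorphism of `A`-algebras from the symmetric algebra of `Lie_{≥ 2}(Ω)` to `P(A)` which
is determined by a choice of representatives of differential forms. -/
def symmetricMap :
    SymmetricAlgebra A (LiePlus A (KaehlerDifferential R A)) →ₐ[A] PoissonEnvelope R A :=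
  SymmetricAlgebra.lift (lieMap τ ∘ₗ LiePlus.incl A (KaehlerDifferential R A))

theorem symmetricMap_ι (y : LiePlus A (KaehlerDifferential R A)) :
    symmetricMap τ (SymmetricAlgebra.ι A _ y) = lieMap τ (LiePlus.incl A _ y) := by
  simp [symmetricMap]

theorem map_symmetricMap_le (d : ℕ) :
    (QPart A (KaehlerDifferential R A) d).map (symmetricMap τ).toLinearMap ≤
      degreePart R A d := by
  rw [QPart, Submodule.map_span_le]
  rintro _ ⟨k, n, y, rfl, rfl⟩
  rw [AlgHom.toLinearMap_apply, map_prod]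
  refine prod_mem_degreePart _ _ fun j => ?_
  rw [symmetricMap_ι, LiePlus.incl_lof]
  exact lieMap_mem τ (y j).2

theorem decomposables_le_map_symmetricMap {d : ℕ}
    (h : ∀ n < d, degreePart R A n ≤
      (QPart A (KaehlerDifferential R A) n).map (symmetricMap τ).toLinearMap) :
    decomposables R A d ≤
      (QPart A (KaehlerDifferential R A) d).map (symmetricMap τ).toLinearMap := by
  refine Submodule.span_le.2 ?_
  rintro _ ⟨e, f, x, y, rfl, hx, hy, rfl⟩
  obtain ⟨p, hp, rfl⟩ := h (e + 1) (by omega) hx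
  obtain ⟨q, hq, rfl⟩ := h (f + 1) (by omega) hy
  refine ⟨p * q, ?_, map_mul (symmetricMap τ) p q⟩
  rw [show e + f + 2 = e + 1 + (f + 1) by omega]
  exact QPart.mul_mem hp hq

theorem map_lieMap_le_map_symmetricMap (n : ℕ) :
    (ModuleLie.degreePart A (KaehlerDifferential R A) (n + 2)).map (lieMap τ) ≤
      (QPart A (KaehlerDifferential R A) (n + 1)).map (symmetricMap τ).toLinearMap := by
  rintro _ ⟨z, hz, rfl⟩
  refine ⟨_, QPart.ι_lof_mem ⟨z, hz⟩, ?_⟩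
  rw [AlgHom.toLinearMap_apply, symmetricMap_ι, LiePlus.incl_lof]

end

section

variable {R A : Type*} [CommRing R] [CommRing A] [Algebra R A]
  {τ : KaehlerDifferential R A →ₗ[A] A ⊗[R] A}
  (hτ : (KaehlerDifferential.D R A : A →ₗ[R] _).liftBaseChange A ∘ₗ τ = LinearMap.id)

include hτ

theorem bracket_algebraMap_algebraMap_mem_liePart (a b : A) :
    (poissonBracket R A).bracket (algebraMap A _ a) (algebraMap A _ b) ∈ liePart τ 1 := by
  rw [← lieMap_lie_D hτ]
  exact lieMap_mem_liePart τ (Submodule.subset_span (.lie (.ι _) (.ι _)))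

theorem bracket_algebraMap_mem_liePart {n : ℕ} (hn : n ≠ 0) {y : PoissonEnvelope R A}
    (hy : y ∈ liePart τ n) (a : A) :
    (poissonBracket R A).bracket y (algebraMap A _ a) ∈ liePart τ (n + 1) := by
  obtain ⟨_, ⟨z, hz, rfl⟩, p, hp, rfl⟩ := Submodule.mem_sup.1 hy
  have hza : ⁅z, ι A (KaehlerDifferential.D R A a)⁆ ∈
      ModuleLie.degreePart A (KaehlerDifferential R A) (n + 1 + 1) :=
    ModuleLie.lie_mem_degreePart hz (Submodule.subset_span (.ι _))
  have hpa : (poissonBracket R A).bracket p (algebraMap A _ a) ∈ decomposables R A (n + 1) := by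
    rw [← add_zero n]
    exact bracket_mem_decomposables_of_left hp (algebraMap_mem_degreePart a)
  rw [LinearMap.map_add₂]
  refine add_mem ?_ (decomposables_le_liePart τ _ hpa)
  rw [← add_sub_cancel (lieMap τ ⁅z, ι A (KaehlerDifferential.D R A a)⁆)
    ((poissonBracket R A).bracket _ _)]
  exact add_mem (lieMap_mem_liePart τ hza)
    (decomposables_le_liePart τ _ (bracket_lieMap_algebraMap_sub_mem hτ hn hz a))

theorem IsMonomial.mem_liePart {d : ℕ} {x : PoissonEnvelope R A} (hx : IsMonomial R d x)
    (hd : d ≠ 0) : x ∈ liePart τ d := by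
  induction hx with
  | of a => exact absurd rfl hd
  | @mul m n x y hx hy ihx ihy =>
    obtain rfl | hm := eq_or_ne m 0
    · obtain ⟨a, rfl⟩ := hx.exists_algebraMap_eq rfl
      rw [zero_add] at hd ⊢
      rw [← Algebra.smul_def]
      exact Submodule.smul_mem _ _ (ihy hd)
    obtain rfl | hn := eq_or_ne n 0
    · obtain ⟨a, rfl⟩ := hy.exists_algebraMap_eq rfl
      rw [mul_comm, ← Algebra.smul_def]
      exact Submodule.smul_mem _ _ (ihx hm)
    exact decomposables_le_liePart τ _ (mul_mem_decomposables hx.mem hy.mem hm hn rfl)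
  | @bracket m n x y hx hy ihx ihy =>
    obtain rfl | hm := eq_or_ne m 0
    · obtain ⟨a, rfl⟩ := hx.exists_algebraMap_eq rfl
      rw [zero_add, ← (poissonBracket R A).neg_bracket]
      refine neg_mem ?_
      obtain rfl | hn := eq_or_ne n 0
      · obtain ⟨b, rfl⟩ := hy.exists_algebraMap_eq rfl
        exact bracket_algebraMap_algebraMap_mem_liePart hτ b a
      · exact bracket_algebraMap_mem_liePart hτ hn (ihy hn) a
    obtain rfl | hn := eq_or_ne n 0
    · obtain ⟨b, rfl⟩ := hy.exists_algebraMap_eq rfl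
      exact bracket_algebraMap_mem_liePart hτ hm (ihx hm) b
    exact bracket_mem_liePart τ hm hn (ihx hm) (ihy hn)

theorem map_symmetricMap (d : ℕ) :
    (QPart A (KaehlerDifferential R A) d).map (symmetricMap τ).toLinearMap =
      degreePart R A d := by
  refine le_antisymm (map_symmetricMap_le τ d) ?_
  induction d using Nat.strong_induction_on with
  | _ d ih =>
    refine Submodule.span_le.2 fun x hx => ?_
    cases d with
    | zero =>
      obtain ⟨a, rfl⟩ := IsMonomial.exists_algebraMap_eq hx rfl
      refine ⟨a • 1, Submodule.smul_mem _ _ QPart.one_mem, ?_⟩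
      rw [AlgHom.toLinearMap_apply, map_smul, map_one, Algebra.algebraMap_eq_smul_one]
    | succ d =>
      exact sup_le (map_lieMap_le_map_symmetricMap τ d) (decomposables_le_map_symmetricMap τ ih)
        (IsMonomial.mem_liePart hτ hx d.succ_ne_zero)

end

end PoissonEnvelope

/-! ### Injectivity -/

namespace PoissonEnvelope

open ModuleLie (ι)

section

variable {R A L : Type*} [CommRing R] [CommRing A] [Algebra R A] [LieRing L] [LieAlgebra A L]
  [Module R L] [IsScalarTower R A L] [Module Aᵐᵒᵖ L] [IsCentralScalar A L] (D : Derivation R A L)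

theorem fst_firstOrderLift_of_isMonomial {n : ℕ} {x : PoissonEnvelope R A}
    (hx : IsMonomial R n x) (hn : n ≠ 0) : (firstOrderLift D x).fst = 0 := by
  induction hx with
  | of a => exact absurd rfl hn
  | @mul m n x y _ _ ihx ihy =>
    rw [map_mul, TrivSqZeroExt.fst_mul]
    obtain rfl | hm := eq_or_ne m 0
    · rw [ihy (by omega), mul_zero]
    · rw [ihx hm, zero_mul]
  | bracket => rw [firstOrderLift_bracket, TrivSqZeroExt.fst_inr]

/-- The component of degree one of `firstOrderLift D`, as a linear map. -/
def firstOrderComponent : (poissonBracket R A).AsLie →ₗ[R] L :=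
  (TrivSqZeroExt.sndHom A L).restrictScalars R ∘ₗ (firstOrderLift D).toLinearMap ∘ₗ
    (poissonBracket R A).toLie.symm.toLinearMap

theorem firstOrderComponent_toLie (x : PoissonEnvelope R A) :
    firstOrderComponent D ((poissonBracket R A).toLie x) = (firstOrderLift D x).snd :=
  rfl

theorem liftBaseChange_firstOrderComponent_lie (s t : ExtendedLie R A) :
    (firstOrderComponent D).liftBaseChange A ⁅s, t⁆ =
      ⁅(firstOrderComponent D).liftBaseChange A s, (firstOrderComponent D).liftBaseChange A t⁆ := by
  induction s using TensorProduct.induction_on with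
  | zero => rw [zero_lie, map_zero, zero_lie]
  | add s s' hs hs' => rw [add_lie, map_add, map_add, hs, hs', add_lie]
  | tmul c x =>
    induction t using TensorProduct.induction_on with
    | zero => rw [lie_zero, map_zero, lie_zero]
    | add t t' ht ht' => rw [lie_add, map_add, map_add, ht, ht', lie_add]
    | tmul e y =>
      obtain ⟨x, rfl⟩ := (poissonBracket R A).toLie.surjective x
      obtain ⟨y, rfl⟩ := (poissonBracket R A).toLie.surjective y
      simp only [PoissonBracket.tmul_lie_tmul, LinearMap.liftBaseChange_tmul,
        firstOrderComponent_toLie, firstOrderLift_bracket, TrivSqZeroExt.snd_inr, smul_lie,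
        lie_smul, mul_smul]
      exact smul_comm ..

/-- The homomorphism of Lie `A`-algebras from the scalar extension of `P(A)` which is given by the
component of degree one of `firstOrderLift D`. -/
def extendedComponent : ExtendedLie R A →ₗ⁅A⁆ L where
  __ := (firstOrderComponent D).liftBaseChange A
  map_lie' := liftBaseChange_firstOrderComponent_lie D _ _

theorem extendedComponent_tmul (c : A) (x : PoissonEnvelope R A) :
    extendedComponent D (c ⊗ₜ (poissonBracket R A).toLie x) = c • (firstOrderLift D x).snd :=
  LinearMap.liftBaseChange_tmul ..

theorem extendedComponent_extendedOfHom (t : A ⊗[R] A) :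
    extendedComponent D (extendedOfHom R A t) = (D : A →ₗ[R] L).liftBaseChange A t := by
  induction t with
  | zero => simp only [map_zero]
  | add s t hs ht => rw [map_add, map_add, map_add, hs, ht]
  | tmul c a =>
    rw [extendedOfHom_tmul, extendedComponent_tmul, firstOrderLift_algebraMap,
      LinearMap.liftBaseChange_tmul, TrivSqZeroExt.snd_add, TrivSqZeroExt.snd_inl,
      TrivSqZeroExt.snd_inr, zero_add]
    rfl

theorem firstOrderLift_scalarMul {n : ℕ} (hn : n ≠ 0) {s : ExtendedLie R A}
    (hs : s ∈ extendedPart R A n) :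
    firstOrderLift D ((poissonBracket R A).scalarMul A s) = .inr (extendedComponent D s) := by
  induction hs using extendedPart_induction with
  | zero => simp only [map_zero, TrivSqZeroExt.inr_zero]
  | add s t _ _ hs ht => rw [map_add, map_add, map_add, hs, ht, TrivSqZeroExt.inr_add]
  | mem c x hx =>
    have hfst := fst_firstOrderLift_of_isMonomial D hx hn
    rw [PoissonBracket.scalarMul_tmul, extendedComponent_tmul, Algebra.smul_def, map_mul,
      firstOrderLift_algebraMap]
    ext <;> simp [hfst]

end

section

variable {R A : Type*} [CommRing R] [CommRing A] [Algebra R A]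
  {τ : KaehlerDifferential R A →ₗ[A] A ⊗[R] A}
  (hτ : (KaehlerDifferential.D R A : A →ₗ[R] _).liftBaseChange A ∘ₗ τ = LinearMap.id)

/-- The structure of an `R`-module on `Lie(Ω)`, by restriction of scalars from `A`. -/
local instance : Module R (ModuleLie A (KaehlerDifferential R A)) :=
  Module.compHom _ (algebraMap R A)

local instance : IsScalarTower R A (ModuleLie A (KaehlerDifferential R A)) :=
  .of_algebraMap_smul fun _ _ => rfl

variable (R A) in
/-- The universal derivation, regarded as a derivation from `A` to `Lie(Ω)`. -/
def lieDerivation : Derivation R A (ModuleLie A (KaehlerDifferential R A)) :=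
  (ι A).compDer (KaehlerDifferential.D R A)

theorem liftKaehlerDifferential_lieDerivation :
    (lieDerivation R A).liftKaehlerDifferential = ι A :=
  Derivation.liftKaehlerDifferential_unique _ _ (Derivation.liftKaehlerDifferential_comp _)

include hτ

theorem extendedComponent_lieHom (z : ModuleLie A (KaehlerDifferential R A)) :
    extendedComponent (lieDerivation R A) (lieHom τ z) = z := by
  have hcomp : (extendedComponent (lieDerivation R A)).comp (lieHom τ) = LieHom.id :=
    ModuleLie.hom_ext fun ω => by
      rw [LieHom.comp_apply, lieHom_ι, extendedComponent_extendedOfHom, LieHom.id_apply,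
        ← liftKaehlerDifferential_lieDerivation,
        ← liftBaseChange_comp_eq_liftKaehlerDifferential hτ]
      rfl
  exact LieHom.congr_fun hcomp z

theorem firstOrderLift_symmetricMap_ι (y : LiePlus A (KaehlerDifferential R A)) :
    firstOrderLift (lieDerivation R A) (symmetricMap τ (SymmetricAlgebra.ι A _ y)) =
      .inr (LiePlus.incl A _ y) := by
  induction y using DirectSum.induction_on with
  | zero => simp only [map_zero, TrivSqZeroExt.inr_zero]
  | add y y' hy hy' => rw [map_add, map_add, map_add, map_add, hy, hy', TrivSqZeroExt.inr_add]
  | of i y =>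
    change firstOrderLift _ (symmetricMap τ (SymmetricAlgebra.ι A _ (DirectSum.lof A ℕ _ i y))) =
      .inr (LiePlus.incl A _ (DirectSum.lof A ℕ _ i y))
    rw [symmetricMap_ι, LiePlus.incl_lof, lieMap_apply,
      firstOrderLift_scalarMul _ i.succ_ne_zero (lieHom_mem τ y.2), extendedComponent_lieHom hτ]

theorem symmetricMap_injective [Algebra.FormallySmooth R A] :
    Function.Injective (symmetricMap τ) := by
  refine injective_of_exists_truncationLinearization_comp_eq
    (T := (firstOrderLift (lieDerivation R A) : PoissonEnvelope R A →+* _))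
    (LiePlus.proj_comp_incl A (KaehlerDifferential R A)) (fun a => ?_)
    (firstOrderLift_symmetricMap_ι hτ) fun k => ?_
  · rw [RingHom.coe_coe, firstOrderLift_algebraMap]
    simp
  · obtain ⟨Φ, hΦ⟩ := exists_truncationLinearization_comp_eq (lieDerivation R A) k
    exact ⟨Φ, AlgHom.congr_fun hΦ⟩

end

end PoissonEnvelope

end

theorem theorem4p1p3_general {R A : Type*} [CommRing R] [CommRing A] [Algebra R A]
    [Algebra.FormallySmooth R A] (d : ℕ) :
    Nonempty (PoissonEnvelope.degreePart R A d ≃ₗ[A] QPart A (KaehlerDifferential R A) d) := by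
  obtain ⟨τ, hτ⟩ := exists_liftBaseChange_D_comp_eq_id (R := R) (A := A)
  have hinj : Function.Injective (PoissonEnvelope.symmetricMap τ).toLinearMap :=
    PoissonEnvelope.symmetricMap_injective hτ
  exact ⟨((Submodule.equivMapOfInjective _ hinj _).trans
    (LinearEquiv.ofEq _ _ (PoissonEnvelope.map_symmetricMap hτ d))).symm⟩

theorem theorem4p1p3 (A : Type*) [CommRing A] [Algebra ℂ A] [Algebra.Smooth ℂ A]
    [Algebra.FiniteType ℂ A] (d : ℕ) :
    Nonempty (PoissonEnvelope.degreePart ℂ A d ≃ₗ[A]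
      QPart A (KaehlerDifferential ℂ A) d) :=
  theorem4p1p3_general d
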